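/- **Setting.** A fusion ring is a (unital, associative, not necessarily commutative) ring $R$ that is free over $\mathbb Z$ with a finite basis $\mathfrak B\ni 1$, such that each product $bb'$ of basis elements is a non-zero combination of basis elements with coefficients in $\mathbb Z_{\ge 0}$, together with an involution $b\mapsto b^*$ of $\mathfrak B$ whose $\mathbb Z$-linear extension is an anti-involution of $R$ and such that the coefficient of $1$ in $bb'$ is $1$ if $b'=b^*$ and $0$ otherwise. $\mathrm{FPdim}(b)$ is the non-negative real eigenvalue of the matrix of multiplication by $b\in\mathfrak B$ that dominates the absolute values of all its eigenvalues; $\mathrm{FPdim}$ is extended $\mathbb Z$-linearly to $R$, and $\mathbb R$ is an $R$-module through $\mathrm{FPdim}$. Let $(W,S)$ be a Coxeter system, $S$ finite, with Coxeter matrix $(m_{s,t})$. Let $R\Lambda_S=\bigoplus_{s\in S}R\alpha_s$ be the free left $R$-module with a geometric $R$-realisation of $(W,S)$: a $\mathbb Z$-bilinear form $B_R:R\Lambda_S\times R\Lambda_S\to R$ with $B_R(x\alpha_s,y\alpha_t)=yB_R(\alpha_s,\alpha_t)x^*$ and $B_R(\alpha_s,\alpha_s)=2$, such that $s(v)=v-B_R(\alpha_s,v)\alpha_s$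 defines a left $R$-linear action of $W$ on $R\Lambda_S$, and such that for $s\ne t$ the entry $r_{s,t}=B_R(\alpha_s,\alpha_t)$ satisfies: $-r_{s,t}$ is a $\mathbb Z_{\ge0}$-combination of $\mathfrak B$; $r_{t,s}=r_{s,t}^*$; and $\mathrm{FPdim}(r_{s,t})=-2\cos(\pi/m_{s,t})$ if $m_{s,t}<\infty$, $\mathrm{FPdim}(r_{s,t})\le-2$ if $m_{s,t}=\infty$. Define the integral matrix $\check r$ on $\mathfrak B\times S$ as follows: $\check r_{(b,s),(b',s)}=2\delta_{b,b'}$, and for $s\neq t$, $\check r_{(b,s),(b',t)}$ is the coefficient of $b$ in $b'r_{s,t}$. (This matrix is symmetric.) The unfolded Coxeter system $(\check W,\mathfrak B\times S)$ has $\check m_{p,q}=2$, $3$ or $\infty$ for $p\neq q$ according to whether $\check r_{p,q}=0$, $\check r_{p,q}=-1$ or $\check r_{p,q}\le-2$. It acts $\mathbb Z$-linearly on $R\Lambda_S$ by $(b,s)(v)=v-B_{\mathbb Z}(b\alpha_s,v)\,b\alpha_s$, where $B_{\mathbb Z}$ is the $\mathbb Z$-bilinear form with matrix $\check r$ in the $\mathbb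 Z$-basis $(b\alpha_s)$ of $R\Lambda_S$. Let $W$ act on $\mathrm{Hom}_R(R\Lambda_S,\mathbb R)$ and $\check W$ on $\mathrm{Hom}_{\mathbb Z}(R\Lambda_S,\mathbb R)\supseteq\mathrm{Hom}_R(R\Lambda_S,\mathbb R)$ by $(wZ)(v)=Z(w^{-1}v)$. A Vinberg pair $(C^\circ,\{s_i\})$ in a finite-dimensional real vector space $V$ consists of the interior $C^\circ\neq\emptyset$ of a closed polyhedral cone $C$ and, for each wall (the linear span of a codimension-one face) of $C$, one linear reflection $s_i$ fixing exactly that wall, such that for every $w$ in the subgroup of $GL(V)$ generated by the $s_i$, $wC^\circ\cap C^\circ\ne\emptyset$ if and only if $w=\mathrm{id}$. A group with a generating family is made into a Vinberg system by a faithful linear representation which sends the generators to the reflections of a Vinberg pair. **Theorem.** Put $$\check C=\{Z\in\mathrm{Hom}_{\mathbb Z}(R\Lambda_S,\mathbb R): Z(b\alpha_s)\ge0\ \forall b\in\mathfrak B,s\in S\},\qquad C=\{Z\in\mathrm{Hom}_R(R\Lambda_S,\mathbb R): Z(\alpha_s)\ge0\ \forall s\in S\},$$ $$\check H_{b\alpha_s}=\{Z\in\mathrm{Hom}_{\mathbb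 Z}(R\Lambda_S,\mathbb R): Z(b\alpha_s)=0\},\qquad H_{\alpha_s}=\{Z\in\mathrm{Hom}_R(R\Lambda_S,\mathbb R): Z(\alpha_s)=0\}.$$ Then: 1. $\check C$ and $C$ are closed convex polyhedral cones, with interiors $\check C^\circ$ and $C^\circ$ given by the corresponding strict inequalities. 2. The walls of $\check C$ are exactly the $\check H_{b\alpha_s}$ ($b\in\mathfrak B$, $s\in S$), and the walls of $C$ are exactly the $H_{\alpha_s}$ ($s\in S$). 3. The fixed subspace of $(b,s)$ in $\mathrm{Hom}_{\mathbb Z}(R\Lambda_S,\mathbb R)$ is exactly $\check H_{b\alpha_s}$, and the fixed subspace of $s$ in $\mathrm{Hom}_R(R\Lambda_S,\mathbb R)$ is exactly $H_{\alpha_s}$. 4. For $w\in\check W$, $w\check C^\circ\cap\check C^\circ\ne\emptyset$ if and only if $w=1$; for $w\in W$, $wC^\circ\cap C^\circ\neq\emptyset$ if and only if $w=1$. 5. The Vinberg pairs $(\check C^\circ,\mathfrak B\times S)$ and $(C^\circ,S)$ make $(\check W,\mathfrak B\times S)$ and $(W,S)$ into Vinberg systems. 6. $C=\check C\cap\mathrm{Hom}_R(R\Lambda_S,\mathbb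 R)$ and $C^\circ=\check C^\circ\cap\mathrm{Hom}_R(R\Lambda_S,\mathbb R)$. 7. For all $s\in S$, $b\in\mathfrak B$: $H_{\alpha_s}=\check H_{b\alpha_s}\cap\mathrm{Hom}_R(R\Lambda_S,\mathbb R)$; moreover $H_{\alpha_s}=\mathrm{Hom}_R(R\Lambda_S,\mathbb R)\cap\bigcap_{b\in\mathfrak B}\check H_{b\alpha_s}$. 8. There is a group homomorphism $\varphi:W\to\check W$ with $\varphi(s)=\prod_{b\in\mathfrak B}(b,s)$ for $s\in S$ (a product of pairwise commuting elements), and for each $s\in S$ the action of $\varphi(s)$ restricted to $\mathrm{Hom}_R(R\Lambda_S,\mathbb R)$ agrees with the action of $s$; in particular its fixed vectors in $\mathrm{Hom}_R(R\Lambda_S,\mathbb R)$ form $H_{\alpha_s}$. -/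

import Mathlib

/-! ### Vinberg systems -/

/-- The interior of a subset of a real vector space for the module topology, which on a
finite-dimensional space is the usual topology. -/
def vecInterior {V : Type*} [AddCommGroup V] [Module ℝ V] (C : Set V) : Set V :=
  @interior V (moduleTopology ℝ V) C

/-- Closedness for the module topology. -/
def IsVecClosed {V : Type*} [AddCommGroup V] [Module ℝ V] (C : Set V) : Prop :=
  @IsClosed V (moduleTopology ℝ V) C

/-- A closed polyhedral cone: a finite intersection of closed linear half-spaces. -/
def IsPolyhedralCone {V : Type*} [AddCommGroup V] [Module ℝ V] (C : Set V) : Prop :=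
  ∃ F : Finset (Module.Dual ℝ V), C = {x | ∀ f ∈ F, 0 ≤ f x}

/-- `H` is a wall of `C`: the linear span of a nonempty face of `C` (a convex extreme subset),
of codimension one. -/
def IsWall {V : Type*} [AddCommGroup V] [Module ℝ V] (C : Set V) (H : Submodule ℝ V) : Prop :=
  ∃ F : Set V, F.Nonempty ∧ IsExtreme ℝ C F ∧ Convex ℝ F ∧ H = Submodule.span ℝ F ∧
    Module.finrank ℝ H + 1 = Module.finrank ℝ V

/-- The subspace of fixed vectors of a linear automorphism. -/
def fixedSubspace {V : Type*} [AddCommGroup V] [Module ℝ V] (g : V ≃ₗ[ℝ] V) : Submodule ℝ V :=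
  LinearMap.eqLocus (g : V →ₗ[ℝ] V) LinearMap.id

/-- A linear reflection (no orthogonality is required): an involution whose fixed vectors form a
hyperplane. -/
def IsLinearReflection {V : Type*} [AddCommGroup V] [Module ℝ V] (g : V ≃ₗ[ℝ] V) : Prop :=
  g * g = 1 ∧ Module.finrank ℝ (fixedSubspace g) + 1 = Module.finrank ℝ V

/-- `(C°, {s i})` is a Vinberg pair: `C` is a closed polyhedral cone with nonempty interior in a
finite-dimensional real vector space, there is one reflection `s i` for each wall of `C`, fixing
that wall, and the nontrivial elements of the group generated by the `s i` move the interior `C°`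
off itself. -/
structure IsVinbergPair {V : Type*} [AddCommGroup V] [Module ℝ V] {I : Type*}
    (C : Set V) (s : I → V ≃ₗ[ℝ] V) : Prop where
  finite_dimensional : FiniteDimensional ℝ V
  finite_index : Finite I
  polyhedral : IsPolyhedralCone C
  interior_nonempty : (vecInterior C).Nonempty
  reflection : ∀ i, IsLinearReflection (s i)
  wall_injective : Function.Injective fun i => fixedSubspace (s i)
  walls : {H : Submodule ℝ V | IsWall C H} = Set.range fun i => fixedSubspace (s i)
  chamber : ∀ w ∈ Subgroup.closure (Set.range s),
    ((w '' vecInterior C) ∩ vecInterior C).Nonempty ↔ w = 1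

/-- The representation `ρ` identifies `(W, gen)` with the Vinberg system of the Vinberg pair
`(C°, ρ ∘ gen)`: it is faithful, `gen` generates `W`, and `(C°, ρ ∘ gen)` is a Vinberg pair. -/
structure IsVinbergSystem {V : Type*} [AddCommGroup V] [Module ℝ V] {W I : Type*} [Group W]
    (C : Set V) (ρ : W →* (V ≃ₗ[ℝ] V)) (gen : I → W) : Prop where
  faithful : Function.Injective ρ
  generates : Subgroup.closure (Set.range gen) = ⊤
  pair : IsVinbergPair C fun i => ρ (gen i)

/-! ### Fusion rings -/

/-- A fusion ring structure on the ring `R`, with finite `ℤ`-basis indexed by `ι`. -/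
structure FusionRing (ι R : Type*) [Fintype ι] [Ring R] where
  basis : Module.Basis ι ℤ R
  /-- the index of the unit -/
  one : ι
  basis_one : basis one = 1
  mul_ne_zero : ∀ j k, basis j * basis k ≠ 0
  mul_nonneg : ∀ j k i, 0 ≤ basis.repr (basis j * basis k) i
  /-- the involution on the basis -/
  dual : ι → ι
  dual_dual : ∀ j, dual (dual j) = j
  /-- the `ℤ`-linear extension of the involution is an anti-involution -/
  star_mul : ∀ x y : R, basis.constr ℤ (fun j => basis (dual j)) (x * y) =
    basis.constr ℤ (fun j => basis (dual j)) y * basis.constr ℤ (fun j => basis (dual j)) x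
  coeff_one_dual : ∀ j, basis.repr (basis j * basis (dual j)) one = 1
  coeff_one_of_ne : ∀ j k, k ≠ dual j → basis.repr (basis j * basis k) one = 0

namespace FusionRing

variable {ι R : Type*} [Fintype ι] [Ring R] (F : FusionRing ι R)

/-- The anti-involution of a fusion ring. -/
noncomputable def star : R →ₗ[ℤ] R := F.basis.constr ℤ fun j => F.basis (F.dual j)

/-- Non-negative elements: non-negative integral combinations of the basis. -/
def IsNonneg (r : R) : Prop := ∀ i, 0 ≤ F.basis.repr r i

/-- The matrix of structure constants `(c_{j k}^l)_{k, l}`, `b_j b_k = ∑ l, c_{j k}^l b_l`. -/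
noncomputable def mulMatrix (j : ι) : Matrix ι ι ℂ :=
  Matrix.of fun k l => ((F.basis.repr (F.basis j * F.basis k) l : ℤ) : ℂ)

/-- The Frobenius-Perron dimension of a basis element: the non-negative real eigenvalue of
`mulMatrix j` that dominates the absolute values of all its complex eigenvalues. (At most one real
number has this property, so `sSup` selects it.) -/
noncomputable def fpDimBasis (j : ι) : ℝ :=
  sSup {x : ℝ | 0 ≤ x ∧ Module.End.HasEigenvalue (F.mulMatrix j).mulVecLin (x : ℂ) ∧
    ∀ μ : ℂ, Module.End.HasEigenvalue (F.mulMatrix j).mulVecLin μ → ‖μ‖ ≤ x}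

/-- The Frobenius-Perron dimension, extended additively to the whole ring. -/
noncomputable def fpDim : R →ₗ[ℤ] ℝ := F.basis.constr ℤ F.fpDimBasis

theorem star_basis (j : ι) : F.star (F.basis j) = F.basis (F.dual j) := by
  rw [star, Module.Basis.constr_basis]

theorem star_mul' (x y : R) : F.star (x * y) = F.star y * F.star x := F.star_mul x y

theorem dual_one : F.dual F.one = F.one := by
  by_contra h
  have h1 := F.coeff_one_of_ne F.one F.one (fun e => h e.symm)
  rw [F.basis_one, mul_one, ← F.basis_one] at h1
  simp at h1

theorem coeff_one_star (x : R) : F.basis.repr (F.star x) F.one = F.basis.repr x F.one := by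
  classical
  have : (F.basis.coord F.one) ∘ₗ F.star = F.basis.coord F.one := by
    refine F.basis.ext fun j => ?_
    simp only [LinearMap.comp_apply, star_basis, Module.Basis.coord_apply,
      Module.Basis.repr_self, Finsupp.single_apply]
    have : F.dual j = F.one ↔ j = F.one := by
      constructor
      · intro h
        rw [← F.dual_dual j, h, F.dual_one]
      · rintro rfl
        exact F.dual_one
    simp [this]
  exact LinearMap.congr_fun this x

theorem coeff_eq (i : ι) (x : R) :
    F.basis.repr x i = F.basis.repr (F.basis (F.dual i) * x) F.one := by
  classical
  have : F.basis.coord i =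
      (F.basis.coord F.one) ∘ₗ (LinearMap.mulLeft ℤ (F.basis (F.dual i))) := by
    refine F.basis.ext fun j => ?_
    simp only [LinearMap.comp_apply, Module.Basis.coord_apply, LinearMap.mulLeft_apply,
      Module.Basis.repr_self, Finsupp.single_apply]
    split_ifs with h
    · subst h
      have := F.coeff_one_dual (F.dual j)
      rw [F.dual_dual] at this
      exact this.symm
    · refine (F.coeff_one_of_ne _ _ ?_).symm
      rwa [F.dual_dual]
  exact LinearMap.congr_fun this x

theorem coeff_one_comm (x y : R) :
    F.basis.repr (x * y) F.one = F.basis.repr (y * x) F.one := by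
  classical
  have key : ∀ j k, F.basis.repr (F.basis j * F.basis k) F.one =
      F.basis.repr (F.basis k * F.basis j) F.one := by
    intro j k
    by_cases h : k = F.dual j
    · subst h
      have := F.coeff_one_dual (F.dual j)
      rw [F.dual_dual] at this
      rw [this, F.coeff_one_dual]
    · rw [F.coeff_one_of_ne j k h, F.coeff_one_of_ne k j]
      rintro rfl
      exact h (F.dual_dual k).symm
  have : (LinearMap.mul ℤ R).compr₂ (F.basis.coord F.one) =
      (LinearMap.mul ℤ R).flip.compr₂ (F.basis.coord F.one) := by
    refine F.basis.ext fun j => F.basis.ext fun k => ?_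
    simpa using key j k
  exact LinearMap.congr_fun (LinearMap.congr_fun this x) y

/-- The form of Frobenius reciprocity that makes the unfolded Cartan matrix symmetric. -/
theorem coeff_mul_star (i j : ι) (x : R) :
    F.basis.repr (F.basis j * x) i = F.basis.repr (F.basis i * F.star x) j := by
  rw [F.coeff_eq i, F.coeff_eq j, ← F.coeff_one_star, star_mul', star_mul', star_basis,
    star_basis, F.dual_dual, mul_assoc, F.coeff_one_comm, mul_assoc]

end FusionRing

/-! ### Realisations over fusion rings -/

/-- The root `α_s` of the free left module `⨁ s, R α_s`. -/
noncomputable def root {S : Type*} (R : Type*) [Ring R] (s : S) : S →₀ R := Finsupp.single s 1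

/-- A realisation over the fusion ring `R` of the Coxeter system `(W, S)`. -/
structure Realisation {ι R S W : Type*} [Fintype ι] [Ring R] [Group W] {M : CoxeterMatrix S}
    (F : FusionRing ι R) (cs : CoxeterSystem M W) where
  /-- the `ℤ`-bilinear form -/
  form : (S →₀ R) →+ (S →₀ R) →+ R
  form_smul : ∀ (x y : R) (s t : S), form (x • root R s) (y • root R t) =
    y * form (root R s) (root R t) * F.star x
  form_self : ∀ s : S, form (root R s) (root R s) = 2
  /-- the assignment `s(v) = v - B(α_s, v) α_s` induces a left `R`-linear action of `W` -/
  exists_action : ∃ σ : W →* Module.End R (S →₀ R), ∀ (s : S) (v : S →₀ R),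
    σ (cs.simple s) v = v - form (root R s) v • root R s

namespace Realisation

variable {ι R S W : Type*} [Fintype ι] [Ring R] [Group W] {M : CoxeterMatrix S}
  {F : FusionRing ι R} {cs : CoxeterSystem M W} (E : Realisation F cs)

/-- The Cartan matrix. -/
noncomputable def cartan (s t : S) : R := E.form (root R s) (root R t)

/-- The (unique) `R`-linear action of `W` with `s(v) = v - B(α_s, v) α_s`. -/
noncomputable def action : W →* Module.End R (S →₀ R) := E.exists_action.choose

theorem action_simple (s : S) (v : S →₀ R) :
    E.action (cs.simple s) v = v - E.form (root R s) v • root R s :=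
  E.exists_action.choose_spec s v

/-- Geometric realisations; the value `M s t = 0` encodes `m_{s,t} = ∞`. -/
structure IsGeometric : Prop where
  nonneg : ∀ s t, s ≠ t → F.IsNonneg (-E.cartan s t)
  cartan_star : ∀ s t, s ≠ t → E.cartan t s = F.star (E.cartan s t)
  fpDim_of_finite : ∀ s t, s ≠ t → M s t ≠ 0 →
    F.fpDim (E.cartan s t) = -2 * Real.cos (Real.pi / M s t)
  fpDim_of_infinite : ∀ s t, s ≠ t → M s t = 0 → F.fpDim (E.cartan s t) ≤ -2

/-! ### The unfolded Coxeter system -/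

open Classical in
/-- The unfolded integral Cartan matrix, indexed by `𝔅 × S`: for `s ≠ t` the entry at
`((b_i, s), (b_j, t))` is the coefficient of `b_i` in `b_j r_{s,t}`. -/
noncomputable def unfoldedCartan (p q : ι × S) : ℤ :=
  if p.2 = q.2 then (if p.1 = q.1 then 2 else 0)
  else F.basis.repr (F.basis q.1 * E.cartan p.2 q.2) p.1

variable {E}

theorem unfoldedCartan_symm (h : E.IsGeometric) (p q : ι × S) :
    E.unfoldedCartan p q = E.unfoldedCartan q p := by
  unfold unfoldedCartan
  by_cases hs : p.2 = q.2
  · simp only [hs, if_true]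
    congr 1
    exact propext eq_comm
  · rw [if_neg hs, if_neg (Ne.symm hs), F.coeff_mul_star, ← h.cartan_star _ _ hs]

open Classical in
/-- The Coxeter matrix of the unfolded Coxeter graph on `𝔅 × S`: distinct `(b_i, s)`, `(b_j, t)`
are joined iff `s ≠ t` and `b_i` appears in `b_j (-r_{s,t})`; the label is `3` if the coefficient
is `1`, and `∞` (encoded by `0`) otherwise. -/
noncomputable def unfoldedMatrix (h : E.IsGeometric) : CoxeterMatrix (ι × S) where
  M := Matrix.of fun p q =>
    if p = q then 1
    else if E.unfoldedCartan p q = 0 then 2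
    else if E.unfoldedCartan p q = -1 then 3
    else 0
  isSymm := by
    ext p q
    simp only [Matrix.transpose_apply, Matrix.of_apply, unfoldedCartan_symm h q p, eq_comm]
  diagonal p := by simp
  off_diagonal p q hpq := by
    simp only [Matrix.of_apply, if_neg hpq]
    split_ifs <;> simp

variable (E)

/-- The `ℤ`-basis `b α_s` of `⨁ s, R α_s`, indexed by `𝔅 × S`. -/
noncomputable def rootBasis (F : FusionRing ι R) (S : Type*) : Module.Basis (ι × S) ℤ (S →₀ R) :=
  F.basis.smulTower (Finsupp.basisSingleOne (R := R) (ι := S))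

theorem rootBasis_apply (F : FusionRing ι R) (S : Type*) (p : ι × S) :
    rootBasis F S p = F.basis p.1 • root R p.2 := by
  simp [rootBasis, root]

/-- The unfolded `ℤ`-bilinear form, transported from `⨁ ℤ α_{b,s}` to `⨁ s, R α_s` by
identifying the basis elements `α_{b,s}` and `b α_s`. -/
noncomputable def unfoldedForm : (S →₀ R) →ₗ[ℤ] (S →₀ R) →ₗ[ℤ] ℤ :=
  (rootBasis F S).constr ℤ fun p => (rootBasis F S).constr ℤ fun q => E.unfoldedCartan p q

/-- The reflection `v ↦ v - B_ℤ(bα_s, v) bα_s`. -/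
noncomputable def unfoldedReflection (p : ι × S) : Module.End ℤ (S →₀ R) :=
  Module.preReflection (rootBasis F S p) (E.unfoldedForm (rootBasis F S p))

theorem unfoldedForm_basis (p q : ι × S) :
    E.unfoldedForm (rootBasis F S p) (rootBasis F S q) = E.unfoldedCartan p q := by
  simp [unfoldedForm]

theorem unfoldedCartan_self (p : ι × S) : E.unfoldedCartan p p = 2 := by
  simp [unfoldedCartan]

theorem unfoldedReflection_apply (p : ι × S) (v : S →₀ R) : E.unfoldedReflection p v =
    v - E.unfoldedForm (rootBasis F S p) v • rootBasis F S p :=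
  Module.preReflection_apply _ _ _

theorem unfoldedReflection_isLiftable (h : E.IsGeometric) :
    (unfoldedMatrix h).IsLiftable E.unfoldedReflection := by
  classical
  intro p q
  have hpp := unfoldedCartan_self E p
  have hqq := unfoldedCartan_self E q
  have hpq := unfoldedCartan_symm h q p
  have hM : unfoldedMatrix h p q = if p = q then 1 else if E.unfoldedCartan p q = 0 then 2
    else if E.unfoldedCartan p q = -1 then 3 else 0 := by
    simp only [unfoldedMatrix, Matrix.of_apply]
  rw [hM]
  split_ifs with h1 h2 h3
  · subst h1
    refine LinearMap.ext fun v => ?_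
    simp only [pow_one, Module.End.mul_apply, unfoldedReflection_apply, unfoldedForm_basis,
      map_sub, map_smul, hpp, Module.End.one_apply]
    module
  · refine LinearMap.ext fun v => ?_
    simp only [pow_two, Module.End.mul_apply, unfoldedReflection_apply, unfoldedForm_basis,
      map_sub, map_smul, hpp, hqq, hpq, h2, Module.End.one_apply]
    module
  · refine LinearMap.ext fun v => ?_
    simp only [pow_succ, pow_zero, one_mul, Module.End.mul_apply, unfoldedReflection_apply,
      unfoldedForm_basis, map_sub, map_smul, hpp, hqq, hpq, h3,
      Module.End.one_apply]
    module
  · simp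

/-- The unfolded Coxeter group. -/
abbrev UnfoldedGroup (h : E.IsGeometric) : Type _ := (unfoldedMatrix h).Group

/-- The unfolded Coxeter system, with simple reflections indexed by `𝔅 × S`. -/
noncomputable def unfoldedSystem (h : E.IsGeometric) : CoxeterSystem (unfoldedMatrix h) (E.UnfoldedGroup h) :=
  (unfoldedMatrix h).toCoxeterSystem

/-- The action of the unfolded Coxeter group on `⨁ s, R α_s` through the unfolded
`ℤ`-realisation: `(b, s)` acts as `v ↦ v - B_ℤ(bα_s, v) bα_s`. -/
noncomputable def unfoldedAction (h : E.IsGeometric) :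
    E.UnfoldedGroup h →* Module.End ℤ (S →₀ R) :=
  (E.unfoldedSystem h).lift ⟨E.unfoldedReflection, E.unfoldedReflection_isLiftable h⟩

theorem unfoldedAction_simple (h : E.IsGeometric) (p : ι × S) :
    E.unfoldedAction h ((E.unfoldedSystem h).simple p) = E.unfoldedReflection p :=
  (E.unfoldedSystem h).lift_apply_simple (E.unfoldedReflection_isLiftable h) p

theorem unfolded_commute (h : E.IsGeometric) (s : S) :
    ((Finset.univ : Finset ι) : Set ι).Pairwise
      (Function.onFun Commute fun b => (E.unfoldedSystem h).simple (b, s)) := by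
  intro b _ c _ hbc
  have hM : unfoldedMatrix h (b, s) (c, s) = 2 := by
    simp [unfoldedMatrix, unfoldedCartan, hbc]
  have h1 := (E.unfoldedSystem h).simple_mul_simple_pow (b, s) (c, s)
  rw [hM, pow_two, mul_eq_one_iff_eq_inv, mul_inv_rev, CoxeterSystem.inv_simple,
    CoxeterSystem.inv_simple] at h1
  exact h1

/-- The product over the basis `∏ b, (b, s)` of the (pairwise commuting) elements `(b, s)`. -/
noncomputable def unfoldedProd (h : E.IsGeometric) (s : S) : E.UnfoldedGroup h :=
  Finset.univ.noncommProd (fun b => (E.unfoldedSystem h).simple (b, s)) (E.unfolded_commute h s)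

end Realisation

/-! ### Contragredient representations -/

/-- `Hom_R(Λ, ℝ)`, where `R` acts on `ℝ` through `d`, as a subspace of `Hom_ℤ(Λ, ℝ)`. -/
def homOver {R : Type*} (Λ : Type*) [Ring R] [AddCommGroup Λ] [Module R Λ] (d : R → ℝ) :
    Submodule ℝ (Λ →+ ℝ) where
  carrier := {Z | ∀ (r : R) (v : Λ), Z (r • v) = d r * Z v}
  add_mem' := by
    intro Z Z' hZ hZ' r v
    simp [hZ r v, hZ' r v, mul_add]
  zero_mem' := by simp
  smul_mem' := by
    intro c Z hZ r v
    simp only [AddMonoidHom.smul_apply, smul_eq_mul, hZ r v]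
    ring

/-- The contragredient action on `Hom_ℤ(Λ, ℝ)`: `(w Z)(v) = Z(w⁻¹ v)`. -/
def contragredient {G R Λ : Type*} [Group G] [Ring R] [AddCommGroup Λ] [Module R Λ]
    (σ : G →* Module.End R Λ) : G →* ((Λ →+ ℝ) ≃ₗ[ℝ] (Λ →+ ℝ)) where
  toFun w :=
    { toFun := fun Z => Z.comp (σ w⁻¹).toAddMonoidHom
      invFun := fun Z => Z.comp (σ w).toAddMonoidHom
      map_add' := fun _ _ => rfl
      map_smul' := fun _ _ => rfl
      left_inv := fun Z => by
        ext v
        change Z ((σ w⁻¹ * σ w) v) = Z v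
        rw [← map_mul]
        simp
      right_inv := fun Z => by
        ext v
        change Z ((σ w * σ w⁻¹) v) = Z v
        rw [← map_mul]
        simp }
  map_one' := by
    ext Z v
    change Z (σ 1⁻¹ v) = Z v
    simp
  map_mul' w w' := by
    ext Z v
    change Z (σ (w * w')⁻¹ v) = Z ((σ w'⁻¹ * σ w⁻¹) v)
    rw [← map_mul, mul_inv_rev]

theorem contragredient_mem {G R Λ : Type*} [Group G] [Ring R] [AddCommGroup Λ] [Module R Λ]
    (σ : G →* Module.End R Λ) (d : R → ℝ) (w : G) {Z : Λ →+ ℝ} (hZ : Z ∈ homOver Λ d) :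
    contragredient σ w Z ∈ homOver Λ d := by
  intro r v
  change Z (σ w⁻¹ (r • v)) = d r * Z (σ w⁻¹ v)
  rw [map_smul]
  exact hZ r _

/-- The contragredient action on `Hom_R(Λ, ℝ)` of a group acting `R`-linearly on `Λ`. -/
def contragredientOver {G R Λ : Type*} [Group G] [Ring R] [AddCommGroup Λ] [Module R Λ]
    (σ : G →* Module.End R Λ) (d : R → ℝ) : G →* (homOver Λ d ≃ₗ[ℝ] homOver Λ d) where
  toFun w :=
    { toFun := fun Z => ⟨contragredient σ w Z, contragredient_mem σ d w Z.2⟩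
      invFun := fun Z => ⟨contragredient σ w⁻¹ Z, contragredient_mem σ d w⁻¹ Z.2⟩
      map_add' := fun _ _ => rfl
      map_smul' := fun _ _ => rfl
      left_inv := fun Z => by
        ext1
        change (contragredient σ w⁻¹ * contragredient σ w) (Z : Λ →+ ℝ) = Z
        rw [← map_mul]
        simp
      right_inv := fun Z => by
        ext1
        change (contragredient σ w * contragredient σ w⁻¹) (Z : Λ →+ ℝ) = Z
        rw [← map_mul]
        simp }
  map_one' := by
    ext1 Z
    ext1
    change contragredient σ 1 (Z : Λ →+ ℝ) = Z
    simp
  map_mul' w w' := by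
    ext1 Z
    ext1
    change contragredient σ (w * w') (Z : Λ →+ ℝ) = contragredient σ w (contragredient σ w' Z)
    simp

namespace Realisation

variable {ι R S W : Type*} [Fintype ι] [Ring R] [Group W] {M : CoxeterMatrix S}
  {F : FusionRing ι R} {cs : CoxeterSystem M W} (E : Realisation F cs)

/-- `Hom_R(RΛ_S, ℝ)`, with `R` acting on `ℝ` through the Frobenius-Perron dimension, inside
`Hom_ℤ(RΛ_S, ℝ)`. -/
noncomputable def homR (F : FusionRing ι R) (S : Type*) : Submodule ℝ ((S →₀ R) →+ ℝ) :=
  homOver (S →₀ R) F.fpDim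

/-- The action of `W` on `Hom_R(RΛ_S, ℝ)`. -/
noncomputable def actR : W →* (homR F S ≃ₗ[ℝ] homR F S) :=
  contragredientOver E.action F.fpDim

/-- The action of the unfolded Coxeter group on `Hom_ℤ(RΛ_S, ℝ)`. -/
noncomputable def actZ (h : E.IsGeometric) :
    E.UnfoldedGroup h →* (((S →₀ R) →+ ℝ) ≃ₗ[ℝ] ((S →₀ R) →+ ℝ)) :=
  contragredient (E.unfoldedAction h)

/-- The cone `Č` in `Hom_ℤ(RΛ_S, ℝ)`. -/
def coneZ (F : FusionRing ι R) (S : Type*) : Set ((S →₀ R) →+ ℝ) :=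
  {Z | ∀ (b : ι) (s : S), 0 ≤ Z (F.basis b • root R s)}

/-- The cone `C` in `Hom_R(RΛ_S, ℝ)`. -/
def coneR (F : FusionRing ι R) (S : Type*) : Set (homR F S) :=
  {Z | ∀ s : S, 0 ≤ (Z : (S →₀ R) →+ ℝ) (root R s)}

/-- The hyperplane `Ȟ_{bα_s}` in `Hom_ℤ(RΛ_S, ℝ)`. -/
def wallZ (F : FusionRing ι R) (b : ι) (s : S) : Submodule ℝ ((S →₀ R) →+ ℝ) where
  carrier := {Z | Z (F.basis b • root R s) = 0}
  add_mem' := by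
    intro Z Z' (hZ : _ = _) (hZ' : _ = _)
    simp [hZ, hZ']
  zero_mem' := by simp
  smul_mem' := by
    intro c Z (hZ : _ = _)
    simp [hZ]

/-- The hyperplane `H_{α_s}` in `Hom_R(RΛ_S, ℝ)`. -/
def wallR (F : FusionRing ι R) (s : S) : Submodule ℝ (homR F S) where
  carrier := {Z | (Z : (S →₀ R) →+ ℝ) (root R s) = 0}
  add_mem' := by
    intro Z Z' (hZ : _ = _) (hZ' : _ = _)
    simp [hZ, hZ']
  zero_mem' := by simp
  smul_mem' := by
    intro c Z (hZ : _ = _)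
    simp [hZ]

end Realisation

/-! The coordinates Z ↦ Z(bα_s) and Z ↦ Z(α_s) identify the two dual spaces with ℝ^(𝔅×S) and ℝ^S,
and turn both cones into orthants. Interiors, walls and fixed hyperplanes are then read off
coordinatewise (`vecInterior_coordCone`, `setOf_isWall_coordCone`, `fixedSubspace_simple`). The real
matrices that govern the two actions are ř and FPdim(r); each has the entries -2cos(π/m), or at most
-2, required of a geometric representation.

The chamber property is Tits' argument. If Z is non-negative on the simple roots and s is not a
right descent of w, then Z(wα_s) ≥ 0 (`orbit_nonneg`): induct on length, splitting off a maximal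
alternating word in two letters, so that only a dihedral computation remains. It follows that the
representations are faithful and that both systems are Vinberg systems
(`isVinbergSystem_coordCone`).

Over R this requires FPdim to be multiplicative and positive on 𝔅. Perron-Frobenius for
multiplication by the sum of the basis yields a positive character (`exists_pos_character`), which
must be FPdim (`eq_fpDim_of_pos`). Positivity also makes Z(bα_s) = FPdim(b)Z(α_s) and Z(α_s) agree
in sign on the smaller space, so chambers and walls restrict as claimed.

The product of the (b,s) over b acts on RΛ_S exactly as s (`unfoldedAction_unfoldedProd`).
Faithfulness of the unfolded action then lifts the Coxeter relations of W to these products, and φ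
exists. -/

/-! ### Positivity of orbits of the fundamental chamber -/

namespace CoxeterSystem

variable {B W : Type*} [Group W] {M : CoxeterMatrix B} (cs : CoxeterSystem M W)

/-- A word alternating between `s` and `t` can be split off `w` on the right in such a way that
lengths add up and neither `s` nor `t` is a right descent of the remaining factor. -/
theorem exists_eq_mul_alternatingWord (w : W) (s t : B) (ht : cs.IsRightDescent w t) :
    ∃ (v : W) (k : ℕ), 0 < k ∧ w = v * cs.wordProd (alternatingWord s t k) ∧
      cs.length w = cs.length v + k ∧ ¬ cs.IsRightDescent v s ∧ ¬ cs.IsRightDescent v t := by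
  classical
  let P : ℕ → Prop := fun k => ∃ v, w = v * cs.wordProd (alternatingWord s t k) ∧
    cs.length w = cs.length v + k
  have hP1 : P 1 := by
    refine ⟨w * cs.simple t, ?_, ?_⟩
    · simp [alternatingWord]
    · exact ((cs.isRightDescent_iff).1 ht).symm
  have hb : ∀ k, P k → k ≤ cs.length w := by
    rintro k ⟨v, -, h⟩
    omega
  have h1 : 1 ≤ Nat.findGreatest P (cs.length w) := Nat.le_findGreatest (hb 1 hP1) hP1
  have hk : P (Nat.findGreatest P (cs.length w)) := Nat.findGreatest_spec (hb 1 hP1) hP1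
  set k := Nat.findGreatest P (cs.length w) with hkdef
  have hmax : ¬ P (k + 1) := fun h => by
    have := Nat.le_findGreatest (hb _ h) h
    omega
  obtain ⟨v, hv, hl⟩ := hk
  -- The letter that would extend the alternating word on the left: were it a descent of `v`, moving
  -- it into the word would contradict maximality of `k`.
  have hnext : ¬ cs.IsRightDescent v (if Even k then t else s) := by
    intro hd
    refine hmax ⟨v * cs.simple (if Even k then t else s), ?_, ?_⟩
    · rw [alternatingWord_succ', wordProd_cons, ← mul_assoc, simple_mul_simple_cancel_right]
      exact hv
    · have := (cs.isRightDescent_iff).1 hd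
      omega
  -- The current first letter of the word: were it a descent of `v`, it would cancel there and make
  -- `w` shorter than `length v + k`.
  have hprev : ¬ cs.IsRightDescent v (if Even k then s else t) := by
    obtain ⟨j, hj⟩ : ∃ j, k = j + 1 := ⟨k - 1, by omega⟩
    have hw : w = v * cs.simple (if Even k then s else t) *
        cs.wordProd (alternatingWord s t j) := by
      rw [hj, alternatingWord_succ', wordProd_cons] at hv
      rw [hv, mul_assoc]
      have : (if Even j then t else s) = (if Even k then s else t) := by
        rw [hj]
        by_cases hej : Even j <;> simp [hej, Nat.even_add_one]
      rw [this]
    intro hd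
    have h2 := cs.length_mul_le (v * cs.simple (if Even k then s else t))
      (cs.wordProd (alternatingWord s t j))
    rw [← hw] at h2
    have h3 := cs.length_wordProd_le (alternatingWord s t j)
    rw [length_alternatingWord] at h3
    have h4 := (cs.isRightDescent_iff).1 hd
    omega
  refine ⟨v, k, h1, hv, hl, ?_⟩
  by_cases hek : Even k
  · simp only [hek, if_true] at hnext hprev
    exact ⟨hprev, hnext⟩
  · simp only [hek, if_false] at hnext hprev
    exact ⟨hnext, hprev⟩

variable {a : B → B → ℝ} (hself : ∀ s, a s s = 2) {f : W → B → ℝ}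
  (hf : ∀ w s t, f (w * cs.simple s) t = f w t - a s t * f w s)
include hself hf

/-- The recurrence sin((k+1)θ) = 2cos θ sin(kθ) - sin((k-1)θ) drives the dihedral orbit. `P` and `Q`
are the values of `f v` at `s` and `t`, in an order depending on the parity of `k`, which the
existential hides. -/
theorem orbit_alternatingWord_of_finite {θ : ℝ} (v : W) (s t : B)
    (hst : a s t = -2 * Real.cos θ) (hts : a t s = -2 * Real.cos θ)
    (hs : 0 ≤ f v s) (ht : 0 ≤ f v t) (k : ℕ) :
    ∃ P Q : ℝ, 0 ≤ P ∧ 0 ≤ Q ∧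
      f (v * cs.wordProd (alternatingWord s t k)) s * Real.sin θ =
        Real.sin ((k + 1) * θ) * P + Real.sin (k * θ) * Q ∧
      f (v * cs.wordProd (alternatingWord s t k)) t * Real.sin θ =
        -(Real.sin (k * θ) * P + Real.sin ((k - 1) * θ) * Q) := by
  induction k generalizing s t with
  | zero =>
    refine ⟨f v s, f v t, hs, ht, ?_, ?_⟩
    · simp [alternatingWord, mul_comm]
    · simp [alternatingWord, mul_comm]
  | succ k ih =>
    obtain ⟨P, Q, hP, hQ, h1, h2⟩ := ih t s hts hst ht hs
    refine ⟨P, Q, hP, hQ, ?_, ?_⟩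
    · rw [alternatingWord_succ, List.concat_eq_append, wordProd_append, wordProd_singleton,
        ← mul_assoc, hf, hts, sub_mul, h2, mul_assoc, h1]
      have e1 : Real.sin (((k + 1 : ℕ) + 1 : ℝ) * θ) =
          2 * Real.cos θ * Real.sin ((k + 1) * θ) - Real.sin (k * θ) := by
        have h3 : ((k + 1 : ℕ) + 1 : ℝ) * θ = (k + 1) * θ + θ := by push_cast; ring
        have h4 : (k : ℝ) * θ = (k + 1) * θ - θ := by ring
        rw [h3, h4, Real.sin_add, Real.sin_sub]
        ring
      have e2 : Real.sin ((k + 1 : ℕ) * θ) =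
          2 * Real.cos θ * Real.sin (k * θ) - Real.sin ((k - 1) * θ) := by
        have h3 : ((k + 1 : ℕ) : ℝ) * θ = k * θ + θ := by push_cast; ring
        have h4 : ((k : ℝ) - 1) * θ = k * θ - θ := by ring
        rw [h3, h4, Real.sin_add, Real.sin_sub]
        ring
      rw [e1, e2]
      ring
    · rw [alternatingWord_succ, List.concat_eq_append, wordProd_append, wordProd_singleton,
        ← mul_assoc, hf, hself, sub_mul, mul_assoc, h1]
      push_cast
      rw [add_sub_cancel_right]
      ring

/-- The non-negativity of the sum is the strengthening that closes the induction: a step sends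
values (x, y) at the reflecting letter and the other one to -x and at least y + 2x. -/
theorem orbit_alternatingWord_of_infinite (v : W) (s t : B)
    (hst : a s t ≤ -2) (hts : a t s ≤ -2)
    (hs : 0 ≤ f v s) (ht : 0 ≤ f v t) (k : ℕ) :
    0 ≤ f (v * cs.wordProd (alternatingWord s t k)) s ∧
      0 ≤ f (v * cs.wordProd (alternatingWord s t k)) s +
        f (v * cs.wordProd (alternatingWord s t k)) t := by
  induction k generalizing s t with
  | zero => simpa [alternatingWord] using ⟨hs, add_nonneg hs ht⟩
  | succ k ih =>
    obtain ⟨h1, h2⟩ := ih t s hts hst ht hs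
    simp only [alternatingWord_succ, List.concat_eq_append, wordProd_append, wordProd_singleton,
        ← mul_assoc, hf, hself]
    constructor <;> nlinarith

/-- If `f w s` is the value at the root `w α_s` of a functional which is non-negative on the
simple roots, then `f w s` is non-negative unless `s` is a right descent of `w`. -/
theorem orbit_nonneg
    (hfin : ∀ s t, s ≠ t → M s t ≠ 0 → a s t = -2 * Real.cos (Real.pi / M s t))
    (hinf : ∀ s t, s ≠ t → M s t = 0 → a s t ≤ -2)
    (h1 : ∀ s, 0 ≤ f 1 s) (w : W) (s : B) (hs : ¬ cs.IsRightDescent w s) : 0 ≤ f w s := by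
  induction hn : cs.length w using Nat.strong_induction_on generalizing w s with
  | _ n ih =>
    by_cases hw : w = 1
    · subst hw
      exact h1 s
    obtain ⟨t, ht⟩ := cs.exists_rightDescent_of_ne_one hw
    have hst : s ≠ t := by
      rintro rfl
      exact hs ht
    -- Since 0 < `k`, the factor `v` is shorter than `w` and has neither letter as a descent, so
    -- induction applies at both `s` and `t`.
    obtain ⟨v, k, hk, hwv, hl, hvs, hvt⟩ := cs.exists_eq_mul_alternatingWord w s t ht
    have pos_s := ih (cs.length v) (by omega) v s hvs rfl
    have pos_t := ih (cs.length v) (by omega) v t hvt rfl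
    by_cases hM : M s t = 0
    · rw [hwv]
      exact (cs.orbit_alternatingWord_of_infinite hself hf v s t (hinf s t hst hM)
        (hinf t s hst.symm (by rwa [M.symmetric])) pos_s pos_t k).1
    -- Additivity of lengths makes the alternating word reduced, which bounds `k` by `M s t`.
    have hlek : k ≤ cs.length (cs.wordProd (alternatingWord s t k)) := by
      have := cs.length_mul_le v (cs.wordProd (alternatingWord s t k))
      rw [← hwv] at this
      omega
    have hkM : k ≤ M s t := by
      by_contra hlt
      refine cs.not_isReduced_alternatingWord s t hM (not_le.1 hlt) (le_antisymm ?_ ?_)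
      · exact cs.length_wordProd_le _
      · simpa using hlek
    -- At `k = M s t` the braid relation rewrites the word so that it ends in `s`, making `s` a
    -- descent of `w`. Hence k + 1 ≤ m, and both sines in the dihedral formula are non-negative.
    have hkM' : k ≠ M s t := by
      intro hkeq
      obtain ⟨j, hj⟩ : ∃ j, k = j + 1 := ⟨k - 1, by omega⟩
      have hbraid : cs.wordProd (alternatingWord s t k) = cs.wordProd (alternatingWord t s k) := by
        have := cs.wordProd_braidWord_eq s t
        rwa [braidWord, braidWord, M.symmetric t s, ← hkeq] at this
      apply hs
      have hws : w * cs.simple s = v * cs.wordProd (alternatingWord s t j) := by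
        rw [hwv, hbraid, hj, alternatingWord_succ, List.concat_eq_append, wordProd_append,
          wordProd_singleton, ← mul_assoc, simple_mul_simple_cancel_right]
      have h2 := cs.length_mul_le v (cs.wordProd (alternatingWord s t j))
      rw [← hws] at h2
      have h3 := cs.length_wordProd_le (alternatingWord s t j)
      rw [length_alternatingWord] at h3
      change cs.length (w * cs.simple s) < cs.length w
      omega
    have hklt : k < M s t := by omega
    have hM2 : 2 ≤ M s t := by
      have := M.off_diagonal s t hst
      change M s t ≠ 1 at this
      omega
    have hMpos : (0 : ℝ) < M s t := by positivity
    obtain ⟨P, Q, hP, hQ, h, -⟩ := cs.orbit_alternatingWord_of_finite hself hf v s t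
      (hfin s t hst hM) (by rw [hfin t s hst.symm (by rwa [M.symmetric]), M.symmetric])
      pos_s pos_t k
    have hsin : 0 < Real.sin (Real.pi / M s t) := by
      apply Real.sin_pos_of_pos_of_lt_pi (by positivity)
      apply div_lt_self Real.pi_pos
      exact_mod_cast hM2
    have hnonneg : ∀ j : ℕ, j ≤ M s t → 0 ≤ Real.sin (j * (Real.pi / M s t)) := by
      intro j hj
      apply Real.sin_nonneg_of_nonneg_of_le_pi (by positivity)
      rw [mul_div_assoc', div_le_iff₀ hMpos, mul_comm]
      have : (j : ℝ) ≤ M s t := by exact_mod_cast hj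
      gcongr
    rw [hwv]
    refine nonneg_of_mul_nonneg_left (b := Real.sin (Real.pi / M s t)) ?_ hsin
    rw [h]
    have h4 := hnonneg (k + 1) hklt
    push_cast at h4
    exact add_nonneg (mul_nonneg h4 hP) (mul_nonneg (hnonneg k hkM) hQ)

/-- A functional positive on all simple roots, whose translate by `w` is again positive on all
simple roots, forces `w = 1`. -/
theorem eq_one_of_orbit_pos
    (hfin : ∀ s t, s ≠ t → M s t ≠ 0 → a s t = -2 * Real.cos (Real.pi / M s t))
    (hinf : ∀ s t, s ≠ t → M s t = 0 → a s t ≤ -2)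
    (h1 : ∀ s, 0 ≤ f 1 s) (w : W) (hw : ∀ s, 0 < f w s) : w = 1 := by
  by_contra hne
  obtain ⟨s, hs⟩ := cs.exists_rightDescent_of_ne_one hne
  -- For a right descent `s` of `w`, the value at `w * s` is non-negative, yet it is minus the
  -- positive value at `w`.
  have h2 := cs.orbit_nonneg hself hf hfin hinf h1 (w * cs.simple s) s
    ((cs.isRightDescent_iff_not_isRightDescent_mul).1 hs)
  rw [hf, hself] at h2
  linarith [hw s]

end CoxeterSystem

/-! ### Simplicial cones in coordinates -/

section SimplicialCone

variable {V I : Type*} [AddCommGroup V] [Module ℝ V] (e : V ≃ₗ[ℝ] (I → ℝ))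

/-- The cone of vectors with non-negative coordinates. -/
def coordCone : Set V := {z | ∀ i, 0 ≤ e z i}

/-- The hyperplane of vectors with vanishing `i`-th coordinate. -/
def coordHyperplane (i : I) : Submodule ℝ V := LinearMap.ker (LinearMap.proj i ∘ₗ e.toLinearMap)

variable {e}

theorem mem_coordHyperplane {i : I} {z : V} : z ∈ coordHyperplane e i ↔ e z i = 0 := by
  simp [coordHyperplane]

variable (e)

theorem convex_coordCone : Convex ℝ (coordCone e) := by
  intro x hx y hy a b ha hb _ i
  simp only [map_add, map_smul, Pi.add_apply, Pi.smul_apply, smul_eq_mul]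
  exact add_nonneg (mul_nonneg ha (hx i)) (mul_nonneg hb (hy i))

theorem coordHyperplane_injective : Function.Injective (coordHyperplane e) := by
  classical
  intro i j hij
  by_contra hne
  have h : e.symm (Pi.single i 1) ∈ coordHyperplane e j := by
    rw [mem_coordHyperplane, e.apply_symm_apply, Pi.single_eq_of_ne (Ne.symm hne)]
  rw [← hij, mem_coordHyperplane, e.apply_symm_apply, Pi.single_eq_same] at h
  exact one_ne_zero h

include e in
theorem finiteDimensional_of_coord [Finite I] : FiniteDimensional ℝ V :=
  Module.Finite.equiv e.symm

theorem finrank_coordHyperplane [Finite I] (i : I) :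
    Module.finrank ℝ (coordHyperplane e i) + 1 = Module.finrank ℝ V := by
  classical
  have := finiteDimensional_of_coord e
  have hne : (LinearMap.proj i ∘ₗ e.toLinearMap : Module.Dual ℝ V) ≠ 0 := by
    intro h
    have h1 := LinearMap.congr_fun h (e.symm (Pi.single i 1))
    simp at h1
  exact Module.Dual.finrank_ker_add_one_of_ne_zero hne

theorem isPolyhedralCone_coordCone [Finite I] : IsPolyhedralCone (coordCone e) := by
  classical
  have := Fintype.ofFinite I
  refine ⟨Finset.univ.image fun i => LinearMap.proj i ∘ₗ e.toLinearMap, ?_⟩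
  ext z
  simp [coordCone]

theorem isVecClosed_coordCone : IsVecClosed (coordCone e) := by
  let : TopologicalSpace V := moduleTopology ℝ V
  have : IsModuleTopology ℝ V := ⟨rfl⟩
  have hc : Continuous e := IsModuleTopology.continuous_of_linearMap e.toLinearMap
  change IsClosed (coordCone e)
  have : coordCone e = ⋂ i, {z | 0 ≤ e z i} := by
    ext z
    simp [coordCone]
  rw [this]
  exact isClosed_iInter fun i => isClosed_le continuous_const ((continuous_apply i).comp hc)

theorem vecInterior_coordCone [Finite I] : vecInterior (coordCone e) = {z | ∀ i, 0 < e z i} := by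
  let : TopologicalSpace V := moduleTopology ℝ V
  have : IsModuleTopology ℝ V := ⟨rfl⟩
  have : ContinuousAdd V := IsModuleTopology.toContinuousAdd ℝ V
  have hc : Continuous e := IsModuleTopology.continuous_of_linearMap e.toLinearMap
  have hc' : Continuous e.symm := IsModuleTopology.continuous_of_linearMap e.symm.toLinearMap
  let h : V ≃ₜ (I → ℝ) := ⟨e.toEquiv, hc, hc'⟩
  change interior (coordCone e) = _
  have hpre : coordCone e = h ⁻¹' (Set.univ.pi fun _ => Set.Ici 0) := by
    ext z
    simp [coordCone, h, Pi.le_def]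
  rw [hpre, ← h.preimage_interior, interior_pi_set Set.finite_univ]
  ext z
  simp [h]

theorem isWall_coordHyperplane [Finite I] (i : I) :
    IsWall (coordCone e) (coordHyperplane e i) := by
  classical
  have := Fintype.ofFinite I
  refine ⟨coordCone e ∩ coordHyperplane e i, ⟨0, ?_, zero_mem _⟩, ⟨Set.inter_subset_left, ?_⟩,
    (convex_coordCone e).inter (coordHyperplane e i).convex, le_antisymm ?_ ?_,
    finrank_coordHyperplane e i⟩
  · intro i
    simp
  · rintro x hx y hy z ⟨-, hz⟩ ⟨a, b, ha, hb, -, rfl⟩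
    refine ⟨hx, ?_⟩
    rw [SetLike.mem_coe, mem_coordHyperplane] at hz ⊢
    simp only [map_add, map_smul, Pi.add_apply, Pi.smul_apply, smul_eq_mul] at hz
    have h1 := mul_nonneg ha.le (hx i)
    have h2 := mul_nonneg hb.le (hy i)
    have h3 : a * e x i = 0 := by linarith
    exact (mul_eq_zero.1 h3).resolve_left ha.ne'
  · intro z hz
    rw [mem_coordHyperplane] at hz
    have : z = ∑ j, e z j • e.symm (Pi.single j 1) := by
      apply e.injective
      ext k
      simp [Finset.sum_apply, Pi.single_apply]
    rw [this]
    -- The `i`-th term vanishes, and every other coordinate vector lies in the face itself.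
    refine Submodule.sum_mem _ fun j _ => ?_
    by_cases hj : j = i
    · subst hj
      simp [hz]
    · refine Submodule.smul_mem _ _ (Submodule.subset_span ⟨fun k => ?_, ?_⟩)
      · rw [e.apply_symm_apply]
        by_cases hk : k = j <;> simp [hk]
      · rw [SetLike.mem_coe, mem_coordHyperplane, e.apply_symm_apply,
          Pi.single_eq_of_ne (Ne.symm hj)]
  · exact Submodule.span_le.2 Set.inter_subset_right

/-- A convex extreme subset of the orthant spans a coordinate subspace as soon as it contains a
vector of full support in that subspace. -/
theorem single_mem_span_of_isExtreme {F : Set V} (hF : IsExtreme ℝ (coordCone e) F)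
    [DecidableEq I] {x : V} (hx : x ∈ F) {i : I} (hi : 0 < e x i) :
    e.symm (Pi.single i 1) ∈ Submodule.span ℝ F := by
  set u : V := e.symm (Pi.single i 1) with hu
  have heu : ∀ j, e u j = (Pi.single i 1 : I → ℝ) j := fun j => by rw [hu, e.apply_symm_apply]
  have hxC := hF.subset hx
  set c := e x i with hc
  -- `x` is the midpoint of `x + c • u` and `x - c • u`. The choice of `c` as the `i`-th coordinate
  -- of `x` keeps both in the orthant, so extremality applies.
  have hmem : x + c • u ∈ F := by
    refine hF.left_mem_of_mem_openSegment (y := x - c • u) ?_ ?_ hx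
      ⟨1 / 2, 1 / 2, by norm_num, by norm_num, by norm_num, by module⟩
    · intro j
      by_cases hj : j = i
      · subst hj
        simp only [map_add, map_smul, Pi.add_apply, Pi.smul_apply, heu, Pi.single_eq_same,
          smul_eq_mul]
        linarith
      · simpa [heu, hj] using hxC j
    · intro j
      by_cases hj : j = i
      · subst hj
        simp [heu, ← hc]
      · simpa [heu, hj] using hxC j
  have h1 : c • u ∈ Submodule.span ℝ F := by
    have := Submodule.sub_mem _ (Submodule.subset_span hmem) (Submodule.subset_span (R := ℝ) hx)
    simpa using this
  have h2 := Submodule.smul_mem _ c⁻¹ h1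
  rwa [smul_smul, inv_mul_cancel₀ hi.ne', one_smul] at h2

/-- If every coordinate were nonzero somewhere on the face, its span would contain all coordinate
vectors and could not have codimension one. So some coordinate vanishes on it, and dimensions force
equality. -/
theorem exists_eq_coordHyperplane_of_isWall [Finite I] {H : Submodule ℝ V}
    (hH : IsWall (coordCone e) H) : ∃ i, coordHyperplane e i = H := by
  classical
  have := Fintype.ofFinite I
  have := finiteDimensional_of_coord e
  obtain ⟨F, -, hF, -, rfl, hrank⟩ := hH
  have hex : ∃ i, Submodule.span ℝ F ≤ coordHyperplane e i := by
    by_contra! hno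
    have htop : Submodule.span ℝ F = ⊤ := by
      rw [eq_top_iff]
      intro z _
      have : z = ∑ j, e z j • e.symm (Pi.single j 1) := by
        apply e.injective
        ext k
        simp [Finset.sum_apply, Pi.single_apply]
      rw [this]
      refine Submodule.sum_mem _ fun j _ => Submodule.smul_mem _ _ ?_
      obtain ⟨x, hx, hxj⟩ : ∃ x ∈ F, e x j ≠ 0 := by
        by_contra! h
        exact hno j (Submodule.span_le.2 fun x hx => mem_coordHyperplane.2 (h x hx))
      exact single_mem_span_of_isExtreme e hF hx (lt_of_le_of_ne (hF.subset hx j) hxj.symm)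
    rw [htop, finrank_top] at hrank
    omega
  obtain ⟨i, hi⟩ := hex
  refine ⟨i, (Submodule.eq_of_le_of_finrank_eq hi ?_).symm⟩
  have := finrank_coordHyperplane e i
  omega

theorem setOf_isWall_coordCone [Finite I] :
    {H | IsWall (coordCone e) H} = Set.range (coordHyperplane e) := by
  ext H
  constructor
  · exact exists_eq_coordHyperplane_of_isWall e
  · rintro ⟨i, rfl⟩
    exact isWall_coordHyperplane e i

end SimplicialCone

/-! ### Vinberg systems from Cartan matrices -/

section Contragredient

variable {V B W : Type*} [AddCommGroup V] [Module ℝ V] [Group W] {M : CoxeterMatrix B}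
  (cs : CoxeterSystem M W) (e : V ≃ₗ[ℝ] (B → ℝ)) (ρ : W →* (V ≃ₗ[ℝ] V)) {a : B → B → ℝ}

theorem fixedSubspace_simple (hself : ∀ s, a s s = 2)
    (hρ : ∀ s z t, e (ρ (cs.simple s) z) t = e z t - a s t * e z s) (s : B) :
    fixedSubspace (ρ (cs.simple s)) = coordHyperplane e s := by
  ext z
  rw [mem_coordHyperplane]
  change ρ (cs.simple s) z = z ↔ _
  constructor
  · intro h
    have := hρ s z s
    rw [h, hself] at this
    linarith
  · intro h
    apply e.injective
    ext t
    rw [hρ, h, mul_zero, sub_zero]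

variable [Finite B] (hself : ∀ s, a s s = 2)
  (hfin : ∀ s t, s ≠ t → M s t ≠ 0 → a s t = -2 * Real.cos (Real.pi / M s t))
  (hinf : ∀ s t, s ≠ t → M s t = 0 → a s t ≤ -2)
  (hρ : ∀ s z t, e (ρ (cs.simple s) z) t = e z t - a s t * e z s)
include hself hfin hinf hρ

theorem image_vecInterior_inter_nonempty_iff (w : W) :
    ((ρ w '' vecInterior (coordCone e)) ∩ vecInterior (coordCone e)).Nonempty ↔ w = 1 := by
  rw [vecInterior_coordCone]
  constructor
  · rintro ⟨_, ⟨z, hz, rfl⟩, hwz⟩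
    rw [← inv_eq_one]
    -- Contragredience: the `s`-coordinate of w⁻¹Z is Z(wα_s), so the orbit function evaluates at
    -- the inverse.
    refine cs.eq_one_of_orbit_pos (f := fun w s => e (ρ w⁻¹ z) s) hself ?_ hfin hinf ?_ w⁻¹ ?_
    · intro w s t
      simp only [mul_inv_rev, CoxeterSystem.inv_simple, map_mul, LinearEquiv.mul_apply]
      exact hρ s _ t
    · intro s
      simpa using (hz s).le
    · simpa using hwz
  · rintro rfl
    refine ⟨e.symm fun _ => 1, ⟨e.symm fun _ => 1, ?_, by simp⟩, ?_⟩ <;> simp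

/-- A linear representation which in suitable coordinates is the contragredient of a geometric
representation makes a Coxeter system into a Vinberg system. -/
theorem isVinbergSystem_coordCone : IsVinbergSystem (coordCone e) ρ cs.simple := by
  have hch := image_vecInterior_inter_nonempty_iff cs e ρ hself hfin hinf hρ
  have hfix := fixedSubspace_simple cs e ρ hself hρ
  have hne : (vecInterior (coordCone e)).Nonempty := by
    rw [vecInterior_coordCone]
    exact ⟨e.symm fun _ => 1, by simp⟩
  have hker : ∀ w, ρ w = 1 → w = 1 := by
    intro w hw
    rw [← hch w, hw]
    obtain ⟨z, hz⟩ := hne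
    exact ⟨z, ⟨z, hz, rfl⟩, hz⟩
  refine ⟨(injective_iff_map_eq_one ρ).2 hker, cs.subgroup_closure_range_simple,
    finiteDimensional_of_coord e, inferInstance, isPolyhedralCone_coordCone e, hne, ?_, ?_, ?_, ?_⟩
  · intro s
    refine ⟨?_, ?_⟩
    · rw [← map_mul, CoxeterSystem.simple_mul_simple_self, map_one]
    · rw [hfix]
      exact finrank_coordHyperplane e s
  · simpa only [hfix] using coordHyperplane_injective e
  · simpa only [hfix] using setOf_isWall_coordCone e
  · intro g hg
    have hrange : Subgroup.closure (Set.range fun i => ρ (cs.simple i)) ≤ ρ.range := by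
      rw [Subgroup.closure_le]
      rintro _ ⟨i, rfl⟩
      exact ⟨_, rfl⟩
    obtain ⟨w, rfl⟩ := hrange hg
    rw [hch w]
    exact ⟨fun h => by rw [h, map_one], hker w⟩

end Contragredient

/-! ### Perron-Frobenius for positive symmetric matrices -/

section PerronFrobenius

open Matrix WithLp

variable {ι : Type*} [Fintype ι]

/-- A positive symmetric matrix has a positive eigenvector. -/
theorem Matrix.exists_pos_eigenvector [Nonempty ι] (N : Matrix ι ι ℝ) (hsymm : N.IsHermitian)
    (hpos : ∀ k l, 0 < N k l) :
    ∃ (r : ℝ) (p : ι → ℝ), 0 < r ∧ (∀ k, 0 < p k) ∧ N *ᵥ p = r • p := by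
  classical
  set T : EuclideanSpace ℝ ι →L[ℝ] EuclideanSpace ℝ ι := toEuclideanCLM (n := ι) (𝕜 := ℝ) N with hT
  have hTsa : IsSelfAdjoint T := by
    have h : IsSelfAdjoint N := hsymm
    exact h.map (toEuclideanCLM (n := ι) (𝕜 := ℝ))
  have hq : ∀ x, T.reApplyInnerSelf x = ∑ k, ∑ l, N k l * x l * x k := by
    intro x
    rw [ContinuousLinearMap.reApplyInnerSelf_apply, EuclideanSpace.inner_eq_star_dotProduct]
    simp [hT, ofLp_toEuclideanCLM, dotProduct, mulVec, Finset.mul_sum, mul_comm]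
  have hcont : Continuous T.reApplyInnerSelf := T.reApplyInnerSelf_continuous
  obtain ⟨x, hx, hmax⟩ := (isCompact_sphere (0 : EuclideanSpace ℝ ι) 1).exists_isMaxOn
    (NormedSpace.sphere_nonempty.2 zero_le_one) hcont.continuousOn
  -- Positive entries ensure that passing to absolute values does not decrease the quadratic form,
  -- so `y` is again a maximiser on the sphere, hence an eigenvector.
  set y : EuclideanSpace ℝ ι := toLp 2 fun k => |x k| with hy
  have hynorm : ‖y‖ = 1 := by
    rw [← mem_sphere_zero_iff_norm.1 hx, EuclideanSpace.norm_eq, EuclideanSpace.norm_eq]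
    simp [hy]
  have hxy : T.reApplyInnerSelf x ≤ T.reApplyInnerSelf y := by
    rw [hq, hq]
    refine Finset.sum_le_sum fun k _ => Finset.sum_le_sum fun l _ => ?_
    rw [mul_assoc, mul_assoc]
    refine mul_le_mul_of_nonneg_left ?_ (hpos k l).le
    simp only [hy]
    rw [← abs_mul]
    exact le_abs_self _
  have hymax : IsMaxOn T.reApplyInnerSelf (Metric.sphere (0 : EuclideanSpace ℝ ι) ‖y‖) y := by
    rw [hynorm]
    exact fun z hz => (hmax hz).trans hxy
  have hy0 : y ≠ 0 := by
    intro h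
    rw [h, norm_zero] at hynorm
    exact zero_ne_one hynorm
  have heig := (hTsa.hasEigenvector_of_isMaxOn hy0 hymax).apply_eq_smul
  set r : ℝ := ⨆ x : { x : EuclideanSpace ℝ ι // x ≠ 0 }, T.rayleighQuotient x
  have hcoord : N *ᵥ ofLp y = r • ofLp y := 
    congrArg ofLp heig
  have hynn : ∀ k, 0 ≤ y k := fun k => abs_nonneg _
  obtain ⟨l₀, hl₀⟩ : ∃ l, y l ≠ 0 := by
    by_contra! h
    exact hy0 (by ext k; exact h k)
  have hprod : ∀ k, 0 < r * y k := by
    intro k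
    have h1 : (N *ᵥ ofLp y) k = r * y k := by rw [hcoord]; rfl
    rw [← h1]
    refine Finset.sum_pos' (fun l _ => mul_nonneg (hpos k l).le (hynn l)) ⟨l₀, Finset.mem_univ _, ?_⟩
    exact mul_pos (hpos k l₀) (lt_of_le_of_ne (hynn l₀) hl₀.symm)
  have hypos : ∀ k, 0 < y k := fun k =>
    lt_of_le_of_ne (hynn k) fun h => by simpa [← h] using hprod k
  exact ⟨r, ofLp y, pos_of_mul_pos_left (hprod l₀) (hynn l₀), hypos, hcoord⟩

/-- The eigenspace of the Perron eigenvalue of a positive matrix is one-dimensional. -/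
theorem Matrix.eq_smul_of_pos_eigenvector [Nonempty ι] {N : Matrix ι ι ℝ}
    (hpos : ∀ k l, 0 < N k l) {r : ℝ} {p v : ι → ℝ} (hp : ∀ k, 0 < p k)
    (hNp : N *ᵥ p = r • p) (hNv : N *ᵥ v = r • v) : ∃ c : ℝ, v = c • p := by
  -- With the minimal ratio c, the vector v - cp is non-negative and vanishes at `k`. Row `k` of the
  -- eigenvalue equation is then a zero sum of non-negative terms, so v = cp.
  obtain ⟨k, -, hk⟩ := Finset.exists_min_image Finset.univ (fun k => v k / p k)
    Finset.univ_nonempty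
  refine ⟨v k / p k, ?_⟩
  set c := v k / p k with hc
  have hu : ∀ l, 0 ≤ v l - c * p l := by
    intro l
    have := (le_div_iff₀ (hp l)).1 (hk l (Finset.mem_univ _))
    linarith
  have huk : v k - c * p k = 0 := by
    rw [hc, div_mul_cancel₀ _ (hp k).ne', sub_self]
  have hsum : ∑ l, N k l * (v l - c * p l) = 0 := by
    have h1 : ∑ l, N k l * v l = r * v k := congrFun hNv k
    have h2 : ∑ l, N k l * p l = r * p k := congrFun hNp k
    have h3 : ∑ l, N k l * (v l - c * p l) = ∑ l, N k l * v l - c * ∑ l, N k l * p l := by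
      rw [Finset.mul_sum, ← Finset.sum_sub_distrib]
      exact Finset.sum_congr rfl fun l _ => by ring
    rw [h3, h1, h2]
    linear_combination r * huk
  ext l
  have h4 := (Finset.sum_eq_zero_iff_of_nonneg
    fun l _ => mul_nonneg (hpos k l).le (hu l)).1 hsum l (Finset.mem_univ _)
  have h5 := (mul_eq_zero.1 h4).resolve_left (hpos k l).ne'
  simp only [Pi.smul_apply, smul_eq_mul]
  linarith

end PerronFrobenius

/-! ### The Frobenius-Perron dimension -/

namespace FusionRing

variable {ι R : Type*} [Fintype ι] [Ring R] (F : FusionRing ι R)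

/-- Cyclicity of the coefficient of 1 turns this entry into the sum of all coefficients of a single
product of basis elements, which is non-zero with non-negative coefficients; hence the positivity
that follows. -/
theorem coeff_basis_mul_sum (k l : ι) :
    F.basis.repr (F.basis k * ∑ i, F.basis i) l =
      ∑ i, F.basis.repr (F.basis (F.dual l) * F.basis k) (F.dual i) := by
  rw [Finset.mul_sum, map_sum, Finsupp.finsetSum_apply]
  refine Finset.sum_congr rfl fun i _ => ?_
  rw [F.coeff_eq l, ← mul_assoc, F.coeff_one_comm, F.coeff_eq (F.dual i), F.dual_dual]

theorem coeff_basis_mul_sum_pos (k l : ι) :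
    0 < F.basis.repr (F.basis k * ∑ i, F.basis i) l := by
  rw [coeff_basis_mul_sum]
  obtain ⟨m, hm⟩ : ∃ m, F.basis.repr (F.basis (F.dual l) * F.basis k) m ≠ 0 := by
    by_contra! h
    refine F.mul_ne_zero (F.dual l) k (F.basis.repr.injective ?_)
    rw [map_zero]
    exact Finsupp.ext h
  refine Finset.sum_pos' (fun i _ => F.mul_nonneg _ _ _) ⟨F.dual m, Finset.mem_univ _, ?_⟩
  rw [F.dual_dual]
  exact lt_of_le_of_ne (F.mul_nonneg _ _ _) hm.symm

theorem star_sum_basis : F.star (∑ i, F.basis i) = ∑ i, F.basis i := by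
  rw [map_sum]
  simp only [star_basis]
  exact Equiv.sum_comp (Function.Involutive.toPerm F.dual F.dual_dual) fun i => F.basis i

theorem map_eq_sum_repr (d : R →ₗ[ℤ] ℝ) (x : R) :
    d x = ∑ l, (F.basis.repr x l : ℝ) * d (F.basis l) := by
  conv_lhs => rw [← F.basis.sum_repr x]
  rw [map_sum]
  exact Finset.sum_congr rfl fun l _ => by rw [map_smul, zsmul_eq_mul]

/-- A fusion ring has a character that is positive on the basis. -/
theorem exists_pos_character : ∃ d : R →ₗ[ℤ] ℝ, (∀ j, 0 < d (F.basis j)) ∧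
    ∀ j k, d (F.basis j * F.basis k) = d (F.basis j) * d (F.basis k) := by
  have : Nonempty ι := ⟨F.one⟩
  set X : R := ∑ i, F.basis i with hX
  let N : Matrix ι ι ℝ := Matrix.of fun k l => (F.basis.repr (F.basis k * X) l : ℝ)
  have hsymm : N.IsHermitian := by
    ext k l
    simp only [N, Matrix.conjTranspose_apply, Matrix.of_apply, star_trivial]
    rw [F.coeff_mul_star k l, hX, star_sum_basis]
  have hpos : ∀ k l, 0 < N k l := by
    intro k l
    simp only [N, Matrix.of_apply]
    exact_mod_cast F.coeff_basis_mul_sum_pos k l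
  obtain ⟨r, p, hr, hp, hNp⟩ := N.exists_pos_eigenvector hsymm hpos
  let P : R →ₗ[ℤ] ℝ := F.basis.constr ℤ p
  have hPb : ∀ k, P (F.basis k) = p k := fun k => F.basis.constr_basis ℤ p k
  have hPX : ∀ x, P (x * X) = r * P x := by
    have : P ∘ₗ LinearMap.mulRight ℤ X = r • P := by
      refine F.basis.ext fun k => ?_
      simp only [LinearMap.comp_apply, LinearMap.mulRight_apply, LinearMap.smul_apply, smul_eq_mul]
      rw [F.map_eq_sum_repr P, hPb]
      simp only [hPb]
      exact congrFun hNp k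
    exact fun x => LinearMap.congr_fun this x
  -- Left multiplication by b_j commutes with right multiplication by `X`, so it preserves the
  -- Perron eigenspace, which is a line. Dividing `P` by `P 1` then makes it a character.
  have hmul : ∀ j, ∃ c : ℝ, ∀ k, P (F.basis j * F.basis k) = c * P (F.basis k) := by
    intro j
    obtain ⟨c, hc⟩ := Matrix.eq_smul_of_pos_eigenvector hpos
      (v := fun k => P (F.basis j * F.basis k)) hp hNp (by
        ext k
        have h1 : P ((F.basis j * F.basis k) * X) = r * P (F.basis j * F.basis k) := hPX _
        rw [mul_assoc] at h1
        have h2 := F.map_eq_sum_repr (P ∘ₗ LinearMap.mulLeft ℤ (F.basis j)) (F.basis k * X)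
        simp only [LinearMap.comp_apply, LinearMap.mulLeft_apply] at h2
        simp only [Pi.smul_apply, smul_eq_mul]
        rw [← h1, h2]
        rfl)
    refine ⟨c, fun k => ?_⟩
    rw [hPb]
    exact congrFun hc k
  have hP1 : 0 < P 1 := by
    rw [← F.basis_one, hPb]
    exact hp _
  refine ⟨(P 1)⁻¹ • P, fun j => ?_, fun j k => ?_⟩
  · simp only [LinearMap.smul_apply, smul_eq_mul, hPb]
    exact mul_pos (inv_pos.2 hP1) (hp j)
  · obtain ⟨c, hc⟩ := hmul j
    have h1 := hc F.one
    rw [F.basis_one, mul_one] at h1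
    simp only [LinearMap.smul_apply, smul_eq_mul, hc k, h1]
    field_simp

/-- A positive character is the Frobenius-Perron dimension. -/
theorem eq_fpDim_of_pos {d : R →ₗ[ℤ] ℝ} (hpos : ∀ j, 0 < d (F.basis j))
    (hmul : ∀ j k, d (F.basis j * F.basis k) = d (F.basis j) * d (F.basis k)) : d = F.fpDim := by
  have : Nonempty ι := ⟨F.one⟩
  refine F.basis.ext fun j => ?_
  rw [fpDim, Module.Basis.constr_basis, fpDimBasis]
  have hsum : ∀ k, ∑ l, (F.basis.repr (F.basis j * F.basis k) l : ℝ) * d (F.basis l) =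
      d (F.basis j) * d (F.basis k) := fun k => by rw [← F.map_eq_sum_repr, hmul]
  have heig : Module.End.HasEigenvalue (F.mulMatrix j).mulVecLin ((d (F.basis j) : ℝ) : ℂ) := by
    refine Module.End.hasEigenvalue_of_hasEigenvector (x := fun k => ((d (F.basis k) : ℝ) : ℂ))
      ⟨Module.End.mem_eigenspace_iff.2 ?_, ?_⟩
    · ext k
      have := congrArg (fun x : ℝ => (x : ℂ)) (hsum k)
      simp only [Complex.ofReal_sum, Complex.ofReal_mul, Complex.ofReal_intCast] at this
      simpa [mulMatrix, Matrix.mulVec, dotProduct] using this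
    · intro h
      have := congrFun h F.one
      simp only [Pi.zero_apply, Complex.ofReal_eq_zero] at this
      exact (hpos _).ne' this
  have hdom : ∀ μ : ℂ, Module.End.HasEigenvalue (F.mulMatrix j).mulVecLin μ →
      ‖μ‖ ≤ d (F.basis j) := by
    intro μ hμ
    obtain ⟨v, hv⟩ := hμ.exists_hasEigenvector
    -- In the sup norm weighted by `d`, multiplication by b_j has operator norm at most d(b_j). Row
    -- `k`, where the weighted norm of `v` is attained, shows this.
    obtain ⟨k, -, hk⟩ := Finset.exists_max_image Finset.univ (fun k => ‖v k‖ / d (F.basis k))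
      Finset.univ_nonempty
    set m := ‖v k‖ / d (F.basis k) with hm
    have hle : ∀ l, ‖v l‖ ≤ m * d (F.basis l) := fun l =>
      (div_le_iff₀ (hpos l)).1 (hk l (Finset.mem_univ _))
    have hvk : ‖v k‖ = m * d (F.basis k) := by rw [hm, div_mul_cancel₀ _ (hpos k).ne']
    have hk0 : 0 < ‖v k‖ := by
      refine lt_of_le_of_ne (norm_nonneg _) fun h => hv.2 ?_
      have hm0 : m = 0 := by rw [hm, ← h, zero_div]
      ext l
      have := hle l
      rw [hm0, zero_mul] at this
      exact norm_le_zero_iff.1 this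
    have hev : ∑ l, ((F.basis.repr (F.basis j * F.basis k) l : ℤ) : ℂ) * v l = μ * v k := by
      have := congrFun hv.apply_eq_smul k
      simpa [mulMatrix, Matrix.mulVec, dotProduct] using this
    have h1 : ‖μ‖ * ‖v k‖ ≤ d (F.basis j) * ‖v k‖ := by
      calc ‖μ‖ * ‖v k‖ = ‖∑ l, ((F.basis.repr (F.basis j * F.basis k) l : ℤ) : ℂ) * v l‖ := by
            rw [hev, norm_mul]
        _ ≤ ∑ l, ‖((F.basis.repr (F.basis j * F.basis k) l : ℤ) : ℂ) * v l‖ := norm_sum_le _ _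
        _ ≤ ∑ l, (F.basis.repr (F.basis j * F.basis k) l : ℝ) * (m * d (F.basis l)) := by
            refine Finset.sum_le_sum fun l _ => ?_
            have h2 : (0 : ℝ) ≤ F.basis.repr (F.basis j * F.basis k) l := by
              exact_mod_cast F.mul_nonneg j k l
            rw [norm_mul, Complex.norm_intCast, abs_of_nonneg h2]
            exact mul_le_mul_of_nonneg_left (hle l) h2
        _ = m * ∑ l, (F.basis.repr (F.basis j * F.basis k) l : ℝ) * d (F.basis l) := by
            rw [Finset.mul_sum]
            exact Finset.sum_congr rfl fun l _ => by ring
        _ = d (F.basis j) * ‖v k‖ := by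
            rw [hsum, hvk]
            ring
    exact le_of_mul_le_mul_right h1 hk0
  have hset : {x : ℝ | 0 ≤ x ∧ Module.End.HasEigenvalue (F.mulMatrix j).mulVecLin (x : ℂ) ∧
      ∀ μ : ℂ, Module.End.HasEigenvalue (F.mulMatrix j).mulVecLin μ → ‖μ‖ ≤ x} =
      {d (F.basis j)} := by
    ext x
    constructor
    · rintro ⟨hx, hx1, hx2⟩
      have h1 := hdom _ hx1
      have h2 := hx2 _ heig
      rw [Complex.norm_of_nonneg hx] at h1
      rw [Complex.norm_of_nonneg (hpos j).le] at h2
      exact le_antisymm h1 h2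
    · rintro rfl
      exact ⟨(hpos j).le, heig, hdom⟩
  rw [hset, csSup_singleton]

theorem fpDim_basis_pos (j : ι) : 0 < F.fpDim (F.basis j) := by
  obtain ⟨d, hpos, hmul⟩ := F.exists_pos_character
  rw [← F.eq_fpDim_of_pos hpos hmul]
  exact hpos j

/-- Not visible from the spectral definition; inherited from the positive character. -/
theorem fpDim_mul (x y : R) : F.fpDim (x * y) = F.fpDim x * F.fpDim y := by
  obtain ⟨d, hpos, hmul⟩ := F.exists_pos_character
  have key : (LinearMap.mul ℤ R).compr₂ F.fpDim = (LinearMap.mul ℤ ℝ).compl₁₂ F.fpDim F.fpDim := by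
    refine F.basis.ext fun j => F.basis.ext fun k => ?_
    rw [← F.eq_fpDim_of_pos hpos hmul]
    exact hmul j k
  exact LinearMap.congr_fun (LinearMap.congr_fun key x) y

theorem fpDim_one : F.fpDim 1 = 1 := by
  have h := F.fpDim_mul 1 1
  have h1 := F.fpDim_basis_pos F.one
  rw [F.basis_one] at h1
  rw [mul_one] at h
  exact (mul_eq_left₀ h1.ne').1 h.symm

end FusionRing

/-! ### The dual spaces of a realisation in coordinates -/

namespace Realisation

section Coordinates

variable {ι R : Type*} [Fintype ι] [Ring R] (F : FusionRing ι R) (S : Type*)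

/-- The coordinates `Z ↦ Z(bα_s)` on `Hom_ℤ(RΛ_S, ℝ)`. -/
noncomputable def coordZ : ((S →₀ R) →+ ℝ) ≃ₗ[ℝ] (ι × S → ℝ) where
  toFun Z p := Z (F.basis p.1 • root R p.2)
  map_add' _ _ := rfl
  map_smul' _ _ := rfl
  invFun z := ((rootBasis F S).constr ℤ z).toAddMonoidHom
  left_inv Z := by
    have h : (rootBasis F S).constr ℤ (fun p : ι × S => Z (F.basis p.1 • root R p.2)) =
        Z.toIntLinearMap := by
      refine (rootBasis F S).ext fun p => ?_
      rw [Module.Basis.constr_basis, rootBasis_apply]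
      rfl
    exact AddMonoidHom.ext fun v => LinearMap.congr_fun h v
  right_inv z := by
    ext p
    change (rootBasis F S).constr ℤ z (F.basis p.1 • root R p.2) = z p
    rw [← rootBasis_apply, Module.Basis.constr_basis]

/-- The coordinates `Z ↦ Z(α_s)` on `Hom_R(RΛ_S, ℝ)`. -/
noncomputable def coordR : homR F S ≃ₗ[ℝ] (S → ℝ) where
  toFun Z s := (Z : (S →₀ R) →+ ℝ) (root R s)
  map_add' _ _ := rfl
  map_smul' _ _ := rfl
  -- The functional xα_s ↦ FPdim(x) z_s; its `R`-linearity is multiplicativity of FPdim.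
  invFun z := ⟨Finsupp.liftAddHom fun s =>
      (AddMonoidHom.mulRight (z s)).comp F.fpDim.toAddMonoidHom, by
    intro r v
    induction v using Finsupp.induction_linear with
    | zero => simp
    | add v w hv hw => rw [smul_add, map_add, map_add, hv, hw, mul_add]
    | single s x =>
      rw [Finsupp.smul_single, smul_eq_mul]
      simp only [Finsupp.liftAddHom_apply_single]
      change F.fpDim (r * x) * z s = F.fpDim r * (F.fpDim x * z s)
      rw [F.fpDim_mul, mul_assoc]⟩
  left_inv Z := by
    ext s x
    have h := Z.2 x (root R s)
    rw [root, Finsupp.smul_single, smul_eq_mul, mul_one] at h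
    simpa [root] using h.symm
  right_inv z := by
    ext s
    simp [root, F.fpDim_one]

theorem coneZ_eq_coordCone : coneZ F S = coordCone (coordZ F S) := by
  ext Z
  exact (Prod.forall (p := fun p => 0 ≤ coordZ F S Z p)).symm

theorem coneR_eq_coordCone : coneR F S = coordCone (coordR F S) := rfl

variable {S}

theorem vecInterior_coneZ [Finite S] : vecInterior (coneZ F S) =
    {Z | ∀ (b : ι) (s : S), 0 < Z (F.basis b • root R s)} := by
  rw [coneZ_eq_coordCone, vecInterior_coordCone]
  ext Z
  exact Prod.forall (p := fun p => 0 < coordZ F S Z p)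

theorem vecInterior_coneR [Finite S] : vecInterior (coneR F S) =
    {Z : homR F S | ∀ s : S, 0 < (Z : (S →₀ R) →+ ℝ) (root R s)} := by
  rw [coneR_eq_coordCone, vecInterior_coordCone]
  rfl

theorem homR_apply_smul_root {Z : (S →₀ R) →+ ℝ} (hZ : Z ∈ homR F S) (b : ι) (s : S) :
    Z (F.basis b • root R s) = F.fpDim (F.basis b) * Z (root R s) := hZ _ _

end Coordinates

/-! ### The two actions in coordinates -/

variable {ι R S W : Type*} [Fintype ι] [Ring R] [Group W] {M : CoxeterMatrix S}
  {F : FusionRing ι R} {cs : CoxeterSystem M W} (E : Realisation F cs)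

theorem form_root_smul_root (s t : S) (y : R) :
    E.form (root R s) (y • root R t) = y * E.cartan s t := by
  have h := E.form_smul 1 y s t
  have h1 : F.star 1 = 1 := by
    rw [← F.basis_one, F.star_basis, F.dual_one]
  rwa [one_smul, h1, mul_one] at h

theorem cartan_self (s : S) : E.cartan s s = 2 := E.form_self s

/-- `R`-linearity of `Z` replaces the Cartan entry by its dimension, so `W` acts through a real
Cartan matrix. -/
theorem coordR_actR_simple (s : S) (Z : homR F S) (t : S) :
    coordR F S (E.actR (cs.simple s) Z) t =
      coordR F S Z t - F.fpDim (E.cartan s t) * coordR F S Z s := by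
  change (Z : (S →₀ R) →+ ℝ) (E.action (cs.simple s)⁻¹ (root R t)) = _
  rw [CoxeterSystem.inv_simple, action_simple, map_sub]
  congr 1
  exact Z.2 _ _

theorem coordZ_actZ_simple (h : E.IsGeometric) (p : ι × S) (Z : (S →₀ R) →+ ℝ) (q : ι × S) :
    coordZ F S (E.actZ h ((E.unfoldedSystem h).simple p) Z) q =
      coordZ F S Z q - (E.unfoldedCartan p q : ℝ) * coordZ F S Z p := by
  change Z (E.unfoldedAction h ((E.unfoldedSystem h).simple p)⁻¹ (F.basis q.1 • root R q.2)) = _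
  rw [CoxeterSystem.inv_simple, unfoldedAction_simple, ← rootBasis_apply, unfoldedReflection_apply,
    unfoldedForm_basis, map_sub, map_zsmul, zsmul_eq_mul, rootBasis_apply, rootBasis_apply]
  rfl

variable {E}

theorem fpDim_cartan_self (s : S) : F.fpDim (E.cartan s s) = 2 := by
  rw [cartan_self, ← one_add_one_eq_two, map_add, F.fpDim_one, one_add_one_eq_two]

theorem unfoldedCartan_nonpos (h : E.IsGeometric) {p q : ι × S} (hpq : p ≠ q) :
    E.unfoldedCartan p q ≤ 0 := by
  unfold unfoldedCartan
  split_ifs with h1 h2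
  · exact absurd (Prod.ext h2 h1) hpq
  · exact le_rfl
  · have hnn : 0 ≤ F.basis.repr (F.basis q.1 * -E.cartan p.2 q.2) p.1 := by
      have e : F.basis q.1 * -E.cartan p.2 q.2 =
          ∑ k, F.basis.repr (-E.cartan p.2 q.2) k • (F.basis q.1 * F.basis k) := by
        conv_lhs => rw [← F.basis.sum_repr (-E.cartan p.2 q.2), Finset.mul_sum]
        exact Finset.sum_congr rfl fun k _ => mul_smul_comm _ _ _
      rw [e, map_sum, Finsupp.finsetSum_apply]
      refine Finset.sum_nonneg fun k _ => ?_
      rw [map_smul, Finsupp.smul_apply, smul_eq_mul]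
      exact mul_nonneg (h.nonneg _ _ h1 k) (F.mul_nonneg _ _ _)
    rw [mul_neg, map_neg, Finsupp.neg_apply] at hnn
    linarith

theorem unfoldedMatrix_apply_of_ne (h : E.IsGeometric) {p q : ι × S} (hpq : p ≠ q) :
    unfoldedMatrix h p q = if E.unfoldedCartan p q = 0 then 2
      else if E.unfoldedCartan p q = -1 then 3 else 0 := by
  simp only [unfoldedMatrix, Matrix.of_apply, if_neg hpq]

/-- The only finite labels are 2 and 3, and 0 = -2cos(π/2), -1 = -2cos(π/3). -/
theorem unfoldedCartan_of_finite (h : E.IsGeometric) {p q : ι × S} (hpq : p ≠ q)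
    (hM : unfoldedMatrix h p q ≠ 0) :
    (E.unfoldedCartan p q : ℝ) = -2 * Real.cos (Real.pi / unfoldedMatrix h p q) := by
  rw [unfoldedMatrix_apply_of_ne h hpq] at hM ⊢
  split_ifs at hM ⊢ with h1 h2
  · rw [h1]
    simp
  · rw [h2]
    simp
  · exact absurd rfl hM

/-- A non-positive integer other than 0 and -1 is at most -2. -/
theorem unfoldedCartan_of_infinite (h : E.IsGeometric) {p q : ι × S} (hpq : p ≠ q)
    (hM : unfoldedMatrix h p q = 0) : (E.unfoldedCartan p q : ℝ) ≤ -2 := by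
  rw [unfoldedMatrix_apply_of_ne h hpq] at hM
  split_ifs at hM with h1 h2
  have h3 := unfoldedCartan_nonpos h hpq
  have h4 : E.unfoldedCartan p q ≤ -2 := by omega
  exact_mod_cast h4

theorem isVinbergSystem_coneZ [Finite S] (h : E.IsGeometric) :
    IsVinbergSystem (coneZ F S) (E.actZ h) (E.unfoldedSystem h).simple := by
  rw [coneZ_eq_coordCone]
  exact isVinbergSystem_coordCone (E.unfoldedSystem h) (coordZ F S) (E.actZ h)
    (a := fun p q => (E.unfoldedCartan p q : ℝ)) (fun p => by simp [unfoldedCartan_self])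
    (fun _ _ => unfoldedCartan_of_finite h) (fun _ _ => unfoldedCartan_of_infinite h)
    (E.coordZ_actZ_simple h)

theorem isVinbergSystem_coneR [Finite S] (h : E.IsGeometric) :
    IsVinbergSystem (coneR F S) E.actR cs.simple :=
  isVinbergSystem_coordCone (V := homR F S) cs (coordR F S) E.actR (a := fun s t => F.fpDim (E.cartan s t))
    fpDim_cartan_self h.fpDim_of_finite h.fpDim_of_infinite E.coordR_actR_simple

theorem fixedSubspace_actZ_simple (h : E.IsGeometric) (b : ι) (s : S) :
    fixedSubspace (E.actZ h ((E.unfoldedSystem h).simple (b, s))) = wallZ F b s :=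
  fixedSubspace_simple (E.unfoldedSystem h) (coordZ F S) (E.actZ h)
    (a := fun p q => (E.unfoldedCartan p q : ℝ)) (fun p => by simp [unfoldedCartan_self])
    (E.coordZ_actZ_simple h) (b, s)

theorem fixedSubspace_actR_simple (s : S) :
    fixedSubspace (V := homR F S) (E.actR (cs.simple s)) = wallR F s :=
  fixedSubspace_simple (V := homR F S) cs (coordR F S) E.actR (a := fun s t => F.fpDim (E.cartan s t))
    fpDim_cartan_self E.coordR_actR_simple s

theorem image_actZ_inter_nonempty_iff [Finite S] (h : E.IsGeometric) (w : E.UnfoldedGroup h) :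
    ((E.actZ h w '' vecInterior (coneZ F S)) ∩ vecInterior (coneZ F S)).Nonempty ↔ w = 1 := by
  rw [coneZ_eq_coordCone]
  exact image_vecInterior_inter_nonempty_iff (E.unfoldedSystem h) (coordZ F S) (E.actZ h)
    (a := fun p q => (E.unfoldedCartan p q : ℝ)) (fun p => by simp [unfoldedCartan_self])
    (fun _ _ => unfoldedCartan_of_finite h) (fun _ _ => unfoldedCartan_of_infinite h)
    (E.coordZ_actZ_simple h) w

theorem image_actR_inter_nonempty_iff [Finite S] (h : E.IsGeometric) (w : W) :
    ((E.actR w '' vecInterior (coneR F S)) ∩ vecInterior (coneR F S)).Nonempty ↔ w = 1 := by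
  rw [coneR_eq_coordCone]
  have h1 := image_vecInterior_inter_nonempty_iff (V := homR F S) cs (coordR F S) E.actR
    (a := fun s t => F.fpDim (E.cartan s t))
    fpDim_cartan_self h.fpDim_of_finite h.fpDim_of_infinite E.coordR_actR_simple w
  exact h1

/-! ### The unfolding homomorphism -/

theorem unfoldedForm_of_fst_ne {b c : ι} (hbc : b ≠ c) (s : S) :
    E.unfoldedForm (rootBasis F S (b, s)) (rootBasis F S (c, s)) = 0 := by
  rw [unfoldedForm_basis]
  simp [unfoldedCartan, hbc]

/-- The roots bα_s with `s` fixed are mutually orthogonal, so the reflections subtract their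
corrections independently. -/
theorem unfoldedAction_noncommProd (h : E.IsGeometric) (s : S) (T : Finset ι) (v : S →₀ R) :
    E.unfoldedAction h (T.noncommProd (fun b => (E.unfoldedSystem h).simple (b, s))
      ((E.unfolded_commute h s).mono (by simp))) v =
    v - ∑ b ∈ T, E.unfoldedForm (rootBasis F S (b, s)) v • rootBasis F S (b, s) := by
  classical
  induction T using Finset.induction_on with
  | empty => simp
  | insert b T hb ih =>
    rw [Finset.noncommProd_insert_of_notMem _ _ _ _ hb, map_mul, Module.End.mul_apply, ih,
      unfoldedAction_simple, unfoldedReflection_apply, Finset.sum_insert hb]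
    have hz : E.unfoldedForm (rootBasis F S (b, s))
        (∑ c ∈ T, E.unfoldedForm (rootBasis F S (c, s)) v • rootBasis F S (c, s)) = 0 := by
      rw [map_sum]
      refine Finset.sum_eq_zero fun c hc => ?_
      rw [map_smul, unfoldedForm_of_fst_ne (by rintro rfl; exact hb hc), smul_zero]
    rw [map_sub, hz, sub_zero]
    abel

/-- At v = b'α_t the left side reassembles b'r_{s,t} from its coefficients in the basis. The
diagonal blocks fit because r_{s,s} = 2. -/
theorem sum_unfoldedForm_smul (s : S) (v : S →₀ R) :
    ∑ b, E.unfoldedForm (rootBasis F S (b, s)) v • rootBasis F S (b, s) =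
      E.form (root R s) v • root R s := by
  classical
  let L : (S →₀ R) →ₗ[ℤ] (S →₀ R) :=
    ∑ b, (E.unfoldedForm (rootBasis F S (b, s))).smulRight (rootBasis F S (b, s))
  let K : (S →₀ R) →ₗ[ℤ] (S →₀ R) :=
    (((smulAddHom R (S →₀ R)).flip (root R s)).comp (E.form (root R s))).toIntLinearMap
  have hLK : L = K := by
    refine (rootBasis F S).ext fun q => ?_
    simp only [L, K, LinearMap.sum_apply, LinearMap.smulRight_apply, unfoldedForm_basis]
    change _ = E.form (root R s) (rootBasis F S q) • root R s
    rw [rootBasis_apply, form_root_smul_root]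
    have hcoef : ∀ b, E.unfoldedCartan (b, s) q =
        F.basis.repr (F.basis q.1 * E.cartan s q.2) b := by
      intro b
      by_cases hs : s = q.2
      · rw [← hs, cartan_self, mul_two, map_add, Finsupp.add_apply, Module.Basis.repr_self]
        by_cases hb : b = q.1
        · simp [unfoldedCartan, hs, hb]
        · simp [unfoldedCartan, hs, hb]
      · simp [unfoldedCartan, hs]
    simp only [hcoef, rootBasis_apply, ← smul_assoc]
    rw [← Finset.sum_smul, F.basis.sum_repr]
  have := LinearMap.congr_fun hLK v
  simpa [L, K, LinearMap.sum_apply] using this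

theorem unfoldedAction_unfoldedProd (h : E.IsGeometric) (s : S) (v : S →₀ R) :
    E.unfoldedAction h (E.unfoldedProd h s) v = E.action (cs.simple s) v := by
  rw [action_simple, ← sum_unfoldedForm_smul]
  exact unfoldedAction_noncommProd h s Finset.univ v

/-- The relation holds for the operators on RΛ_S, where the products act as elements of `W`;
faithfulness of the dual representation of the unfolded group pulls it back. -/
theorem unfoldedProd_isLiftable [Finite S] (h : E.IsGeometric) :
    M.IsLiftable (E.unfoldedProd h) := by
  intro s t
  have key : ∀ (n : ℕ) (v : S →₀ R),
      E.unfoldedAction h ((E.unfoldedProd h s * E.unfoldedProd h t) ^ n) v =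
        E.action ((cs.simple s * cs.simple t) ^ n) v := by
    intro n
    induction n with
    | zero => simp
    | succ n ih =>
      intro v
      rw [pow_succ, pow_succ, map_mul, map_mul, map_mul, map_mul]
      simp only [Module.End.mul_apply, unfoldedAction_unfoldedProd, ih]
  set g := (E.unfoldedProd h s * E.unfoldedProd h t) ^ M s t
  have hg : E.unfoldedAction h g = 1 := by
    refine LinearMap.ext fun v => ?_
    rw [key, cs.simple_mul_simple_pow, map_one]
    rfl
  have hg' : E.unfoldedAction h g⁻¹ = 1 := by
    rw [← mul_one (E.unfoldedAction h g⁻¹), ← hg, ← map_mul, inv_mul_cancel, map_one, hg]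
  refine (isVinbergSystem_coneZ h).faithful ?_
  rw [map_one]
  refine LinearEquiv.ext fun Z => AddMonoidHom.ext fun v => ?_
  change Z (E.unfoldedAction h g⁻¹ v) = Z v
  rw [hg']
  rfl

/-- The unfolding homomorphism `W → W̌`, which sends `s` to `∏ b, (b, s)`. -/
noncomputable def unfolding [Finite S] (h : E.IsGeometric) : W →* E.UnfoldedGroup h :=
  cs.lift ⟨E.unfoldedProd h, unfoldedProd_isLiftable h⟩

theorem unfolding_simple [Finite S] (h : E.IsGeometric) (s : S) :
    unfolding h (cs.simple s) = E.unfoldedProd h s :=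
  cs.lift_apply_simple (unfoldedProd_isLiftable h) s

theorem actZ_unfolding_simple [Finite S] (h : E.IsGeometric) (s : S) (Z : homR F S) :
    E.actZ h (unfolding h (cs.simple s)) (Z : (S →₀ R) →+ ℝ) =
      (E.actR (cs.simple s) Z : (S →₀ R) →+ ℝ) := by
  refine AddMonoidHom.ext fun v => ?_
  change (Z : (S →₀ R) →+ ℝ) (E.unfoldedAction h (unfolding h (cs.simple s))⁻¹ v) =
    (Z : (S →₀ R) →+ ℝ) (E.action (cs.simple s)⁻¹ v)
  rw [← map_inv, CoxeterSystem.inv_simple, unfolding_simple, unfoldedAction_unfoldedProd]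

/-! ### Comparison of the two chambers -/

section Comparison

variable (F) (S)

/-- One inclusion is positivity of FPdim(b); the other needs only b = 1. -/
theorem val_image_coneR : Subtype.val '' coneR F S =
    coneZ F S ∩ (homR F S : Set ((S →₀ R) →+ ℝ)) := by
  ext Z
  constructor
  · rintro ⟨Z, hZ, rfl⟩
    refine ⟨fun b s => ?_, Z.2⟩
    rw [homR_apply_smul_root F Z.2]
    exact mul_nonneg (F.fpDim_basis_pos b).le (hZ s)
  · rintro ⟨hZ, hZR⟩
    refine ⟨⟨Z, hZR⟩, fun s => ?_, rfl⟩
    have h := hZ F.one s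
    rwa [F.basis_one, one_smul] at h

theorem val_image_vecInterior_coneR [Finite S] : Subtype.val '' vecInterior (coneR F S) =
    vecInterior (coneZ F S) ∩ (homR F S : Set ((S →₀ R) →+ ℝ)) := by
  rw [vecInterior_coneR, vecInterior_coneZ]
  ext Z
  constructor
  · rintro ⟨Z, hZ, rfl⟩
    refine ⟨fun b s => ?_, Z.2⟩
    rw [homR_apply_smul_root F Z.2]
    exact mul_pos (F.fpDim_basis_pos b) (hZ s)
  · rintro ⟨hZ, hZR⟩
    refine ⟨⟨Z, hZR⟩, fun s => ?_, rfl⟩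
    have h := hZ F.one s
    rwa [F.basis_one, one_smul] at h

variable {S}

theorem map_wallR (s : S) (b : ι) :
    (wallR F s).map (homR F S).subtype = wallZ F b s ⊓ homR F S := by
  ext Z
  constructor
  · rintro ⟨Z, hZ, rfl⟩
    refine ⟨?_, Z.2⟩
    change (Z : (S →₀ R) →+ ℝ) (F.basis b • root R s) = 0
    rw [homR_apply_smul_root F Z.2]
    exact mul_eq_zero_of_right _ hZ
  · rintro ⟨hZ, hZR⟩
    refine ⟨⟨Z, hZR⟩, ?_, rfl⟩
    change Z (F.basis b • root R s) = 0 at hZ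
    rw [homR_apply_smul_root F hZR] at hZ
    exact (mul_eq_zero.1 hZ).resolve_left (F.fpDim_basis_pos b).ne'

theorem map_wallR_eq_iInf (s : S) :
    (wallR F s).map (homR F S).subtype = homR F S ⊓ ⨅ b : ι, wallZ F b s := by
  apply le_antisymm
  · refine le_inf ?_ (le_iInf fun b => ?_)
    · rw [map_wallR F s F.one]
      exact inf_le_right
    · rw [map_wallR F s b]
      exact inf_le_left
  · rw [map_wallR F s F.one]
    exact le_inf (inf_le_right.trans (iInf_le _ F.one)) inf_le_left

end Comparison

theorem setOf_actZ_unfolding_simple_eq [Finite S] (h : E.IsGeometric) (s : S) :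
    {Z : (S →₀ R) →+ ℝ | Z ∈ homR F S ∧ E.actZ h (unfolding h (cs.simple s)) Z = Z} =
      Subtype.val '' (wallR F s : Set (homR F S)) := by
  rw [← fixedSubspace_actR_simple (E := E)]
  ext Z
  constructor
  · rintro ⟨hZ, hfix⟩
    refine ⟨⟨Z, hZ⟩, ?_, rfl⟩
    exact Subtype.ext ((actZ_unfolding_simple h s ⟨Z, hZ⟩).symm.trans hfix)
  · rintro ⟨Z, hZ, rfl⟩
    exact ⟨Z.2, (actZ_unfolding_simple h s Z).trans (congrArg Subtype.val hZ)⟩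

end Realisation

theorem mainTheorem7 {ι R S W : Type*} [Fintype ι] [Ring R] [Finite S] [Group W]
    {M : CoxeterMatrix S} (F : FusionRing ι R) (cs : CoxeterSystem M W)
    (E : Realisation F cs) (hE : E.IsGeometric) :
    -- closed convex polyhedral cones and their interiors
    (IsPolyhedralCone (Realisation.coneZ F S) ∧ IsVecClosed (Realisation.coneZ F S) ∧
      Convex ℝ (Realisation.coneZ F S) ∧
      vecInterior (Realisation.coneZ F S) =
        {Z | ∀ (b : ι) (s : S), 0 < Z (F.basis b • root R s)}) ∧
    (IsPolyhedralCone (Realisation.coneR F S) ∧ IsVecClosed (Realisation.coneR F S) ∧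
      Convex ℝ (Realisation.coneR F S) ∧
      vecInterior (Realisation.coneR F S) =
        {Z : Realisation.homR F S | ∀ s : S, 0 < (Z : (S →₀ R) →+ ℝ) (root R s)}) ∧
    -- their walls
    {H | IsWall (Realisation.coneZ F S) H} =
      Set.range (fun p : ι × S => Realisation.wallZ F p.1 p.2) ∧
    {H : Submodule ℝ (Realisation.homR F S) | IsWall (Realisation.coneR F S) H} =
      Set.range (fun s : S => Realisation.wallR F s) ∧
    -- the simple reflections fix exactly the walls
    (∀ (b : ι) (s : S),
      fixedSubspace (E.actZ hE ((E.unfoldedSystem hE).simple (b, s))) =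
        Realisation.wallZ F b s) ∧
    (∀ s : S, fixedSubspace (V := Realisation.homR F S) (E.actR (cs.simple s)) = Realisation.wallR F s) ∧
    -- only the identity moves a chamber to a set that meets it
    (∀ w : E.UnfoldedGroup hE,
      ((E.actZ hE w '' vecInterior (Realisation.coneZ F S)) ∩
        vecInterior (Realisation.coneZ F S)).Nonempty ↔ w = 1) ∧
    (∀ w : W,
      ((E.actR w '' vecInterior (Realisation.coneR F S)) ∩
        vecInterior (Realisation.coneR F S)).Nonempty ↔ w = 1) ∧
    -- the two Vinberg systems
    IsVinbergSystem (Realisation.coneZ F S) (E.actZ hE) (E.unfoldedSystem hE).simple ∧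
    IsVinbergSystem (Realisation.coneR F S) E.actR cs.simple ∧
    -- chambers and walls of the smaller space are cut out by those of the larger one
    Subtype.val '' Realisation.coneR F S =
      Realisation.coneZ F S ∩ (Realisation.homR F S : Set ((S →₀ R) →+ ℝ)) ∧
    Subtype.val '' vecInterior (Realisation.coneR F S) =
      vecInterior (Realisation.coneZ F S) ∩ (Realisation.homR F S : Set ((S →₀ R) →+ ℝ)) ∧
    (∀ (s : S) (b : ι), (Realisation.wallR F s).map (Realisation.homR F S).subtype =
      Realisation.wallZ F b s ⊓ Realisation.homR F S) ∧
    (∀ s : S, (Realisation.wallR F s).map (Realisation.homR F S).subtype =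
      Realisation.homR F S ⊓ ⨅ b : ι, Realisation.wallZ F b s) ∧
    -- the unfolding homomorphism restricts to the action of `W`
    ∃ φ : W →* E.UnfoldedGroup hE, ∀ s : S,
      φ (cs.simple s) = E.unfoldedProd hE s ∧
      (∀ Z : Realisation.homR F S, E.actZ hE (φ (cs.simple s)) (Z : (S →₀ R) →+ ℝ) =
        (E.actR (cs.simple s) Z : (S →₀ R) →+ ℝ)) ∧
      {Z : (S →₀ R) →+ ℝ | Z ∈ Realisation.homR F S ∧ E.actZ hE (φ (cs.simple s)) Z = Z} =
        Subtype.val '' (Realisation.wallR F s : Set (Realisation.homR F S)) := by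
  refine ⟨⟨?_, ?_, ?_, Realisation.vecInterior_coneZ F⟩,
    ⟨?_, ?_, ?_, Realisation.vecInterior_coneR F⟩, ?_, ?_,
    Realisation.fixedSubspace_actZ_simple hE, Realisation.fixedSubspace_actR_simple,
    Realisation.image_actZ_inter_nonempty_iff hE, Realisation.image_actR_inter_nonempty_iff hE,
    Realisation.isVinbergSystem_coneZ hE, Realisation.isVinbergSystem_coneR hE,
    Realisation.val_image_coneR S F, Realisation.val_image_vecInterior_coneR S F,
    Realisation.map_wallR F, Realisation.map_wallR_eq_iInf F,
    Realisation.unfolding hE, fun s => ⟨Realisation.unfolding_simple hE s,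
      Realisation.actZ_unfolding_simple hE s,
      Realisation.setOf_actZ_unfolding_simple_eq hE s⟩⟩
  · rw [Realisation.coneZ_eq_coordCone]
    exact isPolyhedralCone_coordCone _
  · rw [Realisation.coneZ_eq_coordCone]
    exact isVecClosed_coordCone _
  · rw [Realisation.coneZ_eq_coordCone]
    exact convex_coordCone _
  · rw [Realisation.coneR_eq_coordCone]
    exact isPolyhedralCone_coordCone (V := Realisation.homR F S) _
  · rw [Realisation.coneR_eq_coordCone]
    exact isVecClosed_coordCone (V := Realisation.homR F S) _
  · rw [Realisation.coneR_eq_coordCone]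
    exact convex_coordCone (V := Realisation.homR F S) _
  · rw [Realisation.coneZ_eq_coordCone]
    exact setOf_isWall_coordCone _
  · rw [Realisation.coneR_eq_coordCone]
    exact setOf_isWall_coordCone (V := Realisation.homR F S) _
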